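/- Let $E$ be a Polish space with a $\sigma$-finite reference measure $\mu$, let $\psi_1,\dots,\psi_n\in L^2(\mu;\mathbb{C})$ ($n\ge 1$) be orthonormal (with fixed measurable representatives), and let $K(x,y)=\sum_{k=1}^n\psi_k(x)\overline{\psi_k(y)}$. Let $\mathcal{S}_{\mathrm c}$ be a determinantal point process on $E$ with kernel $K$ and reference measure $\mu$, i.e. a random locally finite subset of $E$ whose $k$-point correlation function with respect to $\mu^{\otimes k}$ is $\det[K(x_i,x_j)]_{1\le i,j\le k}$ for every $k$. Let $\nu(\mathrm{d}x)=\rho(x)\,\mu(\mathrm{d}x)$ be a non-atomic probability measure with $\rho>0$ $\mu$-almost everywhere, and let $X_1,\dots,X_N$ ($N\ge 1$) be i.i.d. with law $\nu$; write $\mathcal{X}=\{X_1,\dots,X_N\}$. Assume that there is $K_{\max}<\infty$ with $$\frac{K(x,x)}{\rho(x)}\le K_{\max}\qquad\text{for } \nu\text{-almost every } x.$$ Let $\mathbf{\Psi}=[\psi_k(X_i)]\in\mathbb{C}^{N\times n}$, $m=\operatorname{rank}\mathbf{\Psi}$, $\mathbf{D}(\rho^{-1/2})=\operatorname{diag}(\rho(X_1)^{-1/2},\dots,\rho(X_N)^{-1/2})$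 and $$\mathbf{L}=\frac1N\,\mathbf{D}(\rho^{-1/2})\,\mathbf{\Psi}\mathbf{\Psi}^*\,\mathbf{D}(\rho^{-1/2}).$$ Conditionally on $\mathcal{X}$, let $\mathcal{S}_{\mathrm d}\subset\mathcal{X}$ be the $m$-DPP of $\mathbf{L}$: $\mathcal{S}_{\mathrm d}=\{X_i: i\in T\}$, where $T\subset\{1,\dots,N\}$ is distributed as the $L$-ensemble of $\mathbf{L}$ (the law on subsets with weights proportional to $\det\mathbf{L}_T$) conditioned on $|T|=m$. For a configuration $\mathcal{S}$ write $\Lambda_{\mathcal{S}}(f)=\sum_{y\in\mathcal{S}}f(y)$. Then for every bounded measurable $f:E\to\mathbb{R}$ and all $\delta,\delta'\in(0,1)$, with probability at least $1-\delta-\delta'$ over the data set $\mathcal{X}$, $$\mathrm{Var}[\Lambda_{\mathcal{S}_{\mathrm d}}(f)\mid\mathcal{X}]\le 2\,\mathrm{Var}[\Lambda_{\mathcal{S}_{\mathrm c}}(f)]+4\|f\|_\infty^2K_{\max}^2\,\mathscr{E}(n,N,\delta,\delta')$$ and $$\mathrm{Var}[\Lambda_{\mathcal{S}_{\mathrm d}}(f)\mid\mathcal{X}]\ge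 \frac{N-1}{2N}\,\mathrm{Var}[\Lambda_{\mathcal{S}_{\mathrm c}}(f)]-2\|f\|_\infty^2K_{\max}^2\,\mathscr{E}(n,N,\delta,\delta'),$$ where $\|f\|_\infty=\sup_{x\in E}|f(x)|$ and $$\mathscr{E}(n,N,\delta,\delta')=4\sqrt{\frac{2\log(2/\delta')}{N}}+\frac{4}{9N^2}\log^2\Big(\frac{n^2+1}{\delta}\Big)+\frac4N\log\Big(\frac{n^2+1}{\delta}\Big).$$ -/

import Mathlib

open MeasureTheory ProbabilityTheory
open scoped ENNReal Topology Matrix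

namespace DPP

noncomputable section

/-- The linear statistic `Λ_S(f) = ∑_{y ∈ S} f(y)` of a configuration `S`. -/
def linStat {E : Type*} (f : E → ℝ) (S : Set E) : ℝ := ∑' y : S, f y

/-- The sup norm `‖f‖_∞` of a (bounded) function. -/
def supNorm {E : Type*} (f : E → ℝ) : ℝ := ⨆ x, |f x|

/-- A point process on `E`: a random locally finite subset of `E`, with measurable counts. -/
structure IsPointProcess {Ω E : Type*} [MeasurableSpace Ω] [TopologicalSpace E]
    [MeasurableSpace E] (S : Ω → Set E) : Prop where
  locallyFinite : ∀ ω x, ∃ U ∈ 𝓝 x, (S ω ∩ U).Finite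
  measurable_count : ∀ B : Set E, MeasurableSet B →
    Measurable fun ω => ((S ω ∩ B).encard : ℝ≥0∞)

/-- The `k`-th determinant `det [K(x_i, x_j)]` attached to a kernel. -/
def kernelDet {E : Type*} (K : E → E → ℂ) {k : ℕ} (x : Fin k → E) : ℂ :=
  (Matrix.of fun i j => K (x i) (x j)).det

/-- `S ∼ DPP(K, μ)` under `P`: for every `k` the `k`-point correlation function of `S` with
respect to `μ^{⊗k}` is `det [K(x_i, x_j)]`. The defining identity is stated for nonnegative
measurable test functions, where neither side can fail to make sense. -/
structure IsDPP {Ω E : Type*} [MeasurableSpace Ω] [TopologicalSpace E] [MeasurableSpace E]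
    (P : Measure Ω) (S : Ω → Set E) (K : E → E → ℂ) (μ : Measure E) : Prop where
  isPointProcess : IsPointProcess S
  measurable_kernel : Measurable (Function.uncurry K)
  det_nonneg : ∀ k : ℕ, ∀ᵐ x ∂(Measure.pi fun _ : Fin k => μ),
    (kernelDet K x).im = 0 ∧ 0 ≤ (kernelDet K x).re
  correlation : ∀ (k : ℕ) (g : (Fin k → E) → ℝ≥0∞), Measurable g →
    ∫⁻ ω, ∑' x : {x : Fin k → E // Function.Injective x ∧ ∀ i, x i ∈ S ω}, g x ∂P =
      ∫⁻ x, g x * ENNReal.ofReal (kernelDet K x).re ∂(Measure.pi fun _ : Fin k => μ)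

/-- The kernel `K(x, y) = ∑ₖ ψₖ(x) conj(ψₖ(y))`. -/
def projKernel {E : Type*} {n : ℕ} (ψ : Fin n → E → ℂ) (x y : E) : ℂ :=
  ∑ k, ψ k x * (starRingEnd ℂ) (ψ k y)

/-- The (unnormalised) weight `det(L_T)` of a subset `T` in an `L`-ensemble, where `L_T` is the
principal submatrix of `L` indexed by `T`. -/
def lWeight {ι : Type*} [DecidableEq ι] (L : Matrix ι ι ℂ) (T : Finset ι) : ℝ≥0∞ :=
  ENNReal.ofReal (L.submatrix (fun i : T => (i : ι)) (fun i : T => (i : ι))).det.re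

/-- The law of the `L`-ensemble with (positive semidefinite) matrix `L`: the probability
measure on subsets `T` proportional to `det(L_T)`. -/
def lEnsemble {ι : Type*} [Fintype ι] [DecidableEq ι] (L : Matrix ι ι ℂ) :
    Measure (Finset ι) :=
  (∑ T, lWeight L T)⁻¹ • ∑ T, lWeight L T • Measure.dirac T

/-- The law of the `m`-DPP of `L`: the `L`-ensemble conditioned to have cardinality `m`. -/
def mDPP {ι : Type*} [Fintype ι] [DecidableEq ι] (L : Matrix ι ι ℂ) (m : ℕ) :
    Measure (Finset ι) :=
  (lEnsemble L)[|{T : Finset ι | T.card = m}]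

/-- The `N × n` feature matrix `Ψ = [ψₖ(x_i)]` of a data set `x₁, …, x_N`. -/
def featureMatrix {E : Type*} {n N : ℕ} (ψ : Fin n → E → ℂ) (x : Fin N → E) :
    Matrix (Fin N) (Fin n) ℂ :=
  Matrix.of fun i k => ψ k (x i)

/-- The diagonal matrix `D(ρ^{-1/2})` on the data set. -/
def invSqrtDiag {E : Type*} {N : ℕ} (ρ : E → ℝ) (x : Fin N → E) :
    Matrix (Fin N) (Fin N) ℂ :=
  Matrix.diagonal fun i => (((√(ρ (x i)))⁻¹ : ℝ) : ℂ)

/-- The matrix `L = N⁻¹ D(ρ^{-1/2}) Ψ Ψ* D(ρ^{-1/2})`. -/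
def lMatrix {E : Type*} {n N : ℕ} (ψ : Fin n → E → ℂ) (ρ : E → ℝ) (x : Fin N → E) :
    Matrix (Fin N) (Fin N) ℂ :=
  (N : ℂ)⁻¹ •
    (invSqrtDiag ρ x * featureMatrix ψ x * (featureMatrix ψ x)ᴴ * invSqrtDiag ρ x)

/-- The conditional variance `Var[Λ_{S_d}(f) | X]` given the data set `X = {x₁, …, x_N}`: the
variance of the linear statistic of the random subset `S_d = {x_i : i ∈ T}` of the data set,
where `T` follows the `m`-DPP of `L` with `m = rank Ψ`. -/
def discreteVar {E : Type*} {n N : ℕ} (ψ : Fin n → E → ℂ) (ρ : E → ℝ) (f : E → ℝ)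
    (x : Fin N → E) : ℝ :=
  variance (fun T : Finset (Fin N) => linStat f (x '' (T : Set (Fin N))))
    (mDPP (lMatrix ψ ρ x) (featureMatrix ψ x).rank)

/-- The error term `𝓔(n, N, δ, δ')`. -/
def errorTerm (n N : ℕ) (δ δ' : ℝ) : ℝ :=
  4 * √(2 * Real.log (2 / δ') / N)
    + 4 / (9 * (N : ℝ) ^ 2) * Real.log (((n : ℝ) ^ 2 + 1) / δ) ^ 2
    + 4 / (N : ℝ) * Real.log (((n : ℝ) ^ 2 + 1) / δ)

end

end DPP

/-! Put Φ = N^{-1/2} D(ρ^{-1/2}) Ψ, so that L = ΦΦ*. Conditioning the L-ensemble on the maximal size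
m = rank Φ leaves a projection DPP: its one- and two-point functions are the minors of the
orthogonal projection P onto the column space of Φ. Hence the conditional variance is ½ ∑ᵢⱼ (f(xᵢ) −
f(xⱼ))² |Pᵢⱼ|² (`variance_sum_mDPP`). The continuous variance has the same form, with P replaced by
K and the sums by integrals (`IsDPP.variance_linStat`).

The projection depends on the sample in a complicated way, whereas L does not, so P is replaced by
L. Since ΦΦ* and Φ*Φ share their nonzero spectrum, ‖P − L‖_F² ≤ ‖Φ*Φ − 1‖_F²
(`sum_norm_projection_sub_sq_le`). The inequality |a|² ≤ 2|b|² + 2|a − b|², used in both directions,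
produces the factors 2 and ½ of the theorem (`discreteVar_bounds`).

Two random quantities remain. The functional with L in place of P is a double sum over the i.i.d.
sample with mean (N−1)/N times the continuous variance, because its diagonal vanishes; McDiarmid's
inequality controls its deviation. The Gram error is the squared norm of an empirical mean of
vectors in a Hilbert space minus its expectation; McDiarmid's inequality is applied to the norm
itself, whose mean is at most K_max/√N. The functions ψₖ ρ^{-1/2}, set to zero on a null set, turn
the almost sure bound on the kernel into one valid everywhere, as bounded differences require. -/

namespace DPP

/-! ### Cauchy–Binet as a sum over tuples of indices. -/

section CauchyBinet

variable {ι R : Type*} [Fintype ι] [CommRing R]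

/-- Row expansion of the determinant of a product of rectangular matrices. -/
theorem det_mul_eq_sum_submatrix {m : ℕ} (C : Matrix (Fin m) ι R) (U : Matrix ι (Fin m) R) :
    (C * U).det = ∑ p : Fin m → ι, (∏ i, C i (p i)) * (U.submatrix p id).det := by
  classical
  have h : (C * U).det = Matrix.detRowAlternating (fun i => ∑ k, C i k • U k) := by
    change Matrix.det _ = Matrix.det _
    congr 1
    ext i j
    simp [Matrix.mul_apply]
  rw [h]
  have := (Matrix.detRowAlternating (n := Fin m) (R := R)).toMultilinearMap.map_sum
    (fun i (k : ι) => C i k • U k)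
  refine this.trans (Finset.sum_congr rfl fun p _ => ?_)
  refine ((Matrix.detRowAlternating (n := Fin m) (R := R)).toMultilinearMap.map_smul_univ
    (fun i => C i (p i)) (fun i => U (p i))).trans ?_
  rfl

/-- A symmetrised Cauchy–Binet formula. -/
theorem sum_det_submatrix_mul_det_submatrix {m : ℕ} (V : Matrix (Fin m) ι R)
    (U : Matrix ι (Fin m) R) :
    ∑ p : Fin m → ι, (V.submatrix id p).det * (U.submatrix p id).det =
      (m.factorial : R) * (V * U).det := by
  classical
  -- Only the factor in V is expanded by Leibniz. For fixed σ, the sum over p is the row expansion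
  -- of a product whose rows are permuted by σ; the two signs cancel, so all m! permutations
  -- contribute the same determinant.
  have h : ∀ p : Fin m → ι, (V.submatrix id p).det * (U.submatrix p id).det =
      ∑ σ : Equiv.Perm (Fin m), ((Equiv.Perm.sign σ : ℤ) : R) *
        ((∏ i, (V.submatrix σ id) i (p i)) * (U.submatrix p id).det) := by
    intro p
    rw [Matrix.det_apply', Finset.sum_mul]
    exact Finset.sum_congr rfl fun σ _ => by simp [mul_assoc]
  simp_rw [h]
  rw [Finset.sum_comm]
  have h2 : ∀ σ : Equiv.Perm (Fin m), ∑ p : Fin m → ι, ((Equiv.Perm.sign σ : ℤ) : R) *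
        ((∏ i, (V.submatrix σ id) i (p i)) * (U.submatrix p id).det) = (V * U).det := by
    intro σ
    rw [← Finset.mul_sum, ← det_mul_eq_sum_submatrix]
    have : V.submatrix σ id * U = (V * U).submatrix σ id := by
      ext i j; simp [Matrix.mul_apply]
    rw [this, Matrix.det_permute, ← mul_assoc, ← Int.cast_mul, Int.units_coe_mul_self]
    simp
  rw [Finset.sum_congr rfl fun σ _ => h2 σ]
  simp [Fintype.card_perm]

/-- A sum over injective tuples of a function of their range. -/
theorem sum_injective_eq_factorial_mul_sum_card [DecidableEq ι] {m : ℕ} (F : Finset ι → R) :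
    ∑ p : Fin m → ι with Function.Injective p, F (Finset.univ.image p) =
      (m.factorial : R) * ∑ T : Finset ι with T.card = m, F T := by
  classical
  rw [← Finset.sum_fiberwise_of_maps_to (s := Finset.univ.filter fun p : Fin m → ι =>
    Function.Injective p) (t := Finset.univ.filter fun T : Finset ι => T.card = m)
    (g := fun p => Finset.univ.image p)]
  · rw [Finset.mul_sum]
    refine Finset.sum_congr rfl fun T hT => ?_
    have hT' : T.card = m := by simpa using hT
    -- The injective tuples with range T are the m! enumerations of T.
    have hc : (Finset.univ.filter fun p : Fin m → ι =>
        Function.Injective p).filter (fun p => Finset.univ.image p = T) =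
        Finset.univ.image (fun (e : Fin m ≃ T) (i : Fin m) => (e i : ι)) := by
      ext p
      simp only [Finset.mem_filter, Finset.mem_univ, true_and, Finset.mem_image]
      constructor
      · rintro ⟨hp, hi⟩
        refine ⟨Equiv.ofBijective (fun i => ⟨p i, hi ▸ Finset.mem_image_of_mem p
          (Finset.mem_univ i)⟩) ⟨fun a b hab => hp (by simpa using hab), ?_⟩, rfl⟩
        rintro ⟨y, hy⟩
        rw [← hi] at hy
        obtain ⟨i, -, rfl⟩ := Finset.mem_image.1 hy
        exact ⟨i, rfl⟩
      · rintro ⟨e, rfl⟩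
        refine ⟨fun a b hab => e.injective (Subtype.ext hab), ?_⟩
        ext y
        simp only [Finset.mem_image, Finset.mem_univ, true_and]
        constructor
        · rintro ⟨a, rfl⟩; exact (e a).2
        · intro hy; exact ⟨e.symm ⟨y, hy⟩, by simp⟩
    have hs : ∀ p ∈ (Finset.univ.filter fun p : Fin m → ι =>
        Function.Injective p).filter (fun p => Finset.univ.image p = T),
        F (Finset.univ.image p) = F T := by
      intro p hp
      rw [(Finset.mem_filter.1 hp).2]
    rw [Finset.sum_congr rfl hs, Finset.sum_const, hc, Finset.card_image_of_injective]
    · have e0 : Fin m ≃ T := (Fintype.equivFinOfCardEq (by simpa using hT')).symm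
      rw [Finset.card_univ, Fintype.card_equiv e0]
      simp
    · intro e e' h
      ext i
      exact congrFun h i
  · intro p hp
    have hp' : Function.Injective p := by simpa using hp
    simp [Finset.card_image_of_injective _ hp']

end CauchyBinet

/-! ### Generating function and inclusion sums of the principal minors of U G U*. -/

section MinorSums

variable {ι : Type*} [DecidableEq ι]

/-- The principal minor of `L` on the index set `T`. -/
noncomputable def minor (L : Matrix ι ι ℂ) (T : Finset ι) : ℂ :=
  (L.submatrix (fun i : T => (i : ι)) (fun i : T => (i : ι))).det

/-- Weights of the form 1 + (indicator of a point) turn the generating function of the minors into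
inclusion sums. -/
theorem prod_one_add_ite (T : Finset ι) (i : ι) :
    ∏ k ∈ T, (1 + if i = k then (1 : ℂ) else 0) = 1 + if i ∈ T then 1 else 0 := by
  have h : ∀ k, (1 + if i = k then (1 : ℂ) else 0) = if i = k then 2 else 1 := by
    intro k; split_ifs <;> norm_num
  simp_rw [h, Finset.prod_ite_eq]
  split_ifs <;> norm_num

theorem minor_image_eq {m : ℕ} (L : Matrix ι ι ℂ) {p : Fin m → ι} (hp : Function.Injective p) :
    minor L (Finset.univ.image p) = (L.submatrix p p).det := by
  let e : Fin m ≃ (Finset.univ.image p : Finset ι) :=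
    Equiv.ofBijective (fun i => ⟨p i, Finset.mem_image_of_mem p (Finset.mem_univ i)⟩)
      ⟨fun a b hab => hp (by simpa using hab), by
        rintro ⟨y, hy⟩
        obtain ⟨i, -, rfl⟩ := Finset.mem_image.1 hy
        exact ⟨i, rfl⟩⟩
  rw [minor, ← Matrix.det_submatrix_equiv_self e]
  rfl

variable [Fintype ι]

/-- The generating function of the principal minors of order `m` of `U G U*`. -/
theorem sum_prod_mul_minor {m : ℕ} (U : Matrix ι (Fin m) ℂ) (G : Matrix (Fin m) (Fin m) ℂ)
    (z : ι → ℂ) :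
    ∑ T : Finset ι with T.card = m, (∏ i ∈ T, z i) * minor (U * G * Uᴴ) T =
      G.det * (Uᴴ * Matrix.diagonal z * U).det := by
  -- At order m, the number of columns of U, all three factors become square and the minor
  -- factorises.
  have h0 : ∀ p : Fin m → ι, ((U * G * Uᴴ).submatrix p p).det =
      (U.submatrix p id).det * G.det * (Uᴴ.submatrix id p).det := by
    intro p
    rw [← Matrix.det_mul, ← Matrix.det_mul]
    congr 1
  have h1 := sum_injective_eq_factorial_mul_sum_card (m := m)
    (fun T : Finset ι => (∏ i ∈ T, z i) * minor (U * G * Uᴴ) T)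
  -- A tuple with a repetition gives U a repeated row and contributes zero, so the sum extends to
  -- all tuples, where Cauchy–Binet applies.
  have h2 : ∑ p : Fin m → ι with Function.Injective p,
      (∏ i ∈ Finset.univ.image p, z i) * minor (U * G * Uᴴ) (Finset.univ.image p) =
      ∑ p : Fin m → ι, G.det *
        (((Uᴴ * Matrix.diagonal z).submatrix id p).det * (U.submatrix p id).det) := by
    rw [Finset.sum_filter]
    refine Finset.sum_congr rfl fun p _ => ?_
    have h3 : ((Uᴴ * Matrix.diagonal z).submatrix id p).det =
        (∏ i, z (p i)) * (Uᴴ.submatrix id p).det := by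
      rw [← Matrix.det_mul_row]
      congr 1
      ext i j
      simp [Matrix.mul_diagonal, mul_comm]
    split_ifs with hp
    · rw [minor_image_eq _ hp, h0, Finset.prod_image (fun a _ b _ h => hp h), h3]
      ring
    · have : (U.submatrix p id).det = 0 := by
        simp only [Function.Injective, not_forall] at hp
        obtain ⟨a, b, hab, hne⟩ := hp
        exact Matrix.det_zero_of_row_eq hne (by ext j; simp [hab])
      simp [this]
  rw [h2, ← Finset.mul_sum, sum_det_submatrix_mul_det_submatrix] at h1
  have hm : (m.factorial : ℂ) ≠ 0 := by exact_mod_cast m.factorial_ne_zero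
  apply mul_left_cancel₀ hm
  rw [← h1]
  ring

variable {m : ℕ} (U : Matrix ι (Fin m) ℂ) (G : Matrix (Fin m) (Fin m) ℂ)

theorem sum_minor (hU : Uᴴ * U = 1) :
    ∑ T : Finset ι with T.card = m, minor (U * G * Uᴴ) T = G.det := by
  simpa [hU] using sum_prod_mul_minor U G 1

/-- As U*U = 1, the matrix on the left is the identity plus the Gram matrix of the rows of U
selected by q. Sylvester's identity trades this m × m determinant for a k × k one in the entries of
the projection UU*; k = 1 and k = 2 suffice for a variance. -/
theorem det_conjTranspose_mul_diagonal_mul (hU : Uᴴ * U = 1) {k : ℕ} (q : Fin k → ι) :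
    (Uᴴ * Matrix.diagonal (fun i => 1 + ∑ a, if q a = i then (1 : ℂ) else 0) * U).det =
      (1 + (U * Uᴴ).submatrix q q).det := by
  have h : Uᴴ * Matrix.diagonal (fun i => 1 + ∑ a, if q a = i then (1 : ℂ) else 0) * U =
      1 + (U.submatrix q id)ᴴ * U.submatrix q id := by
    have h1 : Matrix.diagonal (fun i => 1 + ∑ a, if q a = i then (1 : ℂ) else 0) =
        1 + Matrix.diagonal (fun i => ∑ a, if q a = i then (1 : ℂ) else 0) := by
      rw [← Matrix.diagonal_one, Matrix.diagonal_add]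
    rw [h1, Matrix.mul_add, Matrix.add_mul, Matrix.mul_one, hU]
    congr 1
    ext i j
    rw [Matrix.mul_apply, Matrix.mul_apply]
    simp_rw [Matrix.mul_diagonal, Matrix.conjTranspose_apply, Matrix.submatrix_apply, id,
      Finset.mul_sum, Finset.sum_mul]
    rw [Finset.sum_comm]
    refine Finset.sum_congr rfl fun a _ => ?_
    rw [Finset.sum_eq_single (q a)] <;> simp +contextual [eq_comm]
  rw [h, Matrix.det_one_add_mul_comm]
  congr 1

/-- Sum of the minors over the sets containing `i`. -/
theorem sum_minor_mem (hU : Uᴴ * U = 1) (i : ι) :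
    ∑ T : Finset ι with T.card = m, (if i ∈ T then 1 else 0) * minor (U * G * Uᴴ) T =
      G.det * (U * Uᴴ) i i := by
  have h1 := sum_prod_mul_minor U G (fun k => 1 + ∑ a : Fin 1, if ![i] a = k then (1 : ℂ) else 0)
  rw [det_conjTranspose_mul_diagonal_mul U hU, Matrix.det_fin_one] at h1
  have h2 : ∀ T : Finset ι, (∏ k ∈ T, (1 + ∑ a : Fin 1, if ![i] a = k then (1 : ℂ) else 0)) =
      1 + if i ∈ T then 1 else 0 := by
    intro T
    simpa using prod_one_add_ite T i
  simp_rw [h2, add_mul, Finset.sum_add_distrib, one_mul] at h1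
  rw [sum_minor U G hU] at h1
  simp only [Matrix.add_apply, Matrix.submatrix_apply, Matrix.one_apply_eq, Matrix.cons_val_zero]
    at h1
  linear_combination h1

/-- Sum of the minors over the sets containing `i` and `j`. -/
theorem sum_minor_mem_mem (hU : Uᴴ * U = 1) {i j : ι} (hij : i ≠ j) :
    ∑ T : Finset ι with T.card = m,
      ((if i ∈ T then 1 else 0) * (if j ∈ T then 1 else 0)) * minor (U * G * Uᴴ) T =
      G.det * ((U * Uᴴ) i i * (U * Uᴴ) j j - (U * Uᴴ) i j * (U * Uᴴ) j i) := by
  have h1 := sum_prod_mul_minor U G (fun k => 1 + ∑ a : Fin 2, if ![i, j] a = k then (1 : ℂ) else 0)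
  rw [det_conjTranspose_mul_diagonal_mul U hU, Matrix.det_fin_two] at h1
  have h2 : ∀ T : Finset ι, (∏ k ∈ T, (1 + ∑ a : Fin 2, if ![i, j] a = k then (1 : ℂ) else 0)) =
      (1 + if i ∈ T then 1 else 0) * (1 + if j ∈ T then 1 else 0) := by
    intro T
    rw [← prod_one_add_ite T i, ← prod_one_add_ite T j, ← Finset.prod_mul_distrib]
    refine Finset.prod_congr rfl fun k _ => ?_
    by_cases h1 : i = k
    · subst h1; simp [hij.symm, Fin.sum_univ_two, -Finset.sum_boole]
    · simp [h1, Fin.sum_univ_two, -Finset.sum_boole]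
  have hi := sum_minor_mem U G hU i
  have hj := sum_minor_mem U G hU j
  -- Inclusion–exclusion: removing the total mass and both one-point sums isolates the pair term.
  have h3 : ∀ T : Finset ι, (1 + if i ∈ T then (1 : ℂ) else 0) * (1 + if j ∈ T then 1 else 0) *
      minor (U * G * Uᴴ) T = minor (U * G * Uᴴ) T + (if i ∈ T then 1 else 0) *
      minor (U * G * Uᴴ) T + (if j ∈ T then 1 else 0) * minor (U * G * Uᴴ) T +
      ((if i ∈ T then 1 else 0) * (if j ∈ T then 1 else 0)) * minor (U * G * Uᴴ) T := by
    intro T; ring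
  simp_rw [h2, h3, Finset.sum_add_distrib] at h1
  rw [sum_minor U G hU, hi, hj] at h1
  simp only [Matrix.add_apply, Matrix.submatrix_apply, Matrix.one_apply_eq, Matrix.cons_val_zero,
    Matrix.cons_val_one, Matrix.one_apply_ne (zero_ne_one' (Fin 2)),
    Matrix.one_apply_ne (one_ne_zero' (Fin 2))] at h1
  linear_combination h1

end MinorSums

/-! ### The m-DPP of ΦΦ* with m = rank Φ as a projection DPP. -/

section DiscreteDPP

open scoped ComplexOrder

section RangeProjection

variable {ι : Type*} [Fintype ι] [DecidableEq ι]

/-- An orthonormal basis of the column space of `Φ`, as a matrix. -/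
theorem exists_orthonormal_columns {n : ℕ} (Φ : Matrix ι (Fin n) ℂ) :
    ∃ U : Matrix ι (Fin Φ.rank) ℂ, Uᴴ * U = 1 ∧ U * Uᴴ * Φ = Φ := by
  let v := (EuclideanSpace.basisFun (Fin n) ℂ).toBasis
  let w := (EuclideanSpace.basisFun ι ℂ).toBasis
  let W := LinearMap.range (Matrix.toLin v w Φ)
  have hr : Module.finrank ℂ W = Φ.rank := (Φ.rank_eq_finrank_range_toLin w v).symm
  let b : OrthonormalBasis (Fin Φ.rank) ℂ W := (stdOrthonormalBasis ℂ W).reindex (finCongr hr)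
  have hcol : ∀ j i, (Matrix.toLin v w Φ (v j)) i = Φ i j := by
    intro j i
    rw [Matrix.toLin_self]
    simp [w, Finset.sum_apply, Pi.single_apply]
  have hU : (Matrix.of fun (i : ι) (k : Fin Φ.rank) => (b k : EuclideanSpace ℂ ι) i)ᴴ *
      (Matrix.of fun (i : ι) (k : Fin Φ.rank) => (b k : EuclideanSpace ℂ ι) i) = 1 := by
    ext k l
    have := (orthonormal_iff_ite.1 b.orthonormal) k l
    rw [Submodule.coe_inner, PiLp.inner_apply] at this
    rw [Matrix.one_apply, ← this, Matrix.mul_apply]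
    simp [mul_comm]
  refine ⟨Matrix.of fun i k => (b k : EuclideanSpace ℂ ι) i, hU, ?_⟩
  ext i j
  have hs := b.sum_repr' ⟨Matrix.toLin v w Φ (v j), LinearMap.mem_range_self _ _⟩
  have hs' := congrArg (fun y : W => (y : EuclideanSpace ℂ ι) i) hs
  simp only [Submodule.coe_inner, PiLp.inner_apply] at hs'
  simp only [hcol] at hs'
  rw [← hs', Matrix.mul_assoc, Matrix.mul_apply]
  simp [Matrix.mul_apply, Finset.sum_apply, mul_comm]

omit [DecidableEq ι] in
-- If G denotes the compressed matrix, ΦΦ* = U G U* has the rank of Φ, which is the size of G, so G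
-- is invertible. Its determinant is the normalising constant of the m-DPP.
theorem det_compression_ne_zero {n : ℕ} (Φ : Matrix ι (Fin n) ℂ) (U : Matrix ι (Fin Φ.rank) ℂ)
    (hP : U * Uᴴ * Φ = Φ) : (Uᴴ * Φ * (Uᴴ * Φ)ᴴ).det ≠ 0 := by
  have h1 : U * (Uᴴ * Φ * (Uᴴ * Φ)ᴴ) * Uᴴ = Φ * Φᴴ := by
    have h2 : (U * Uᴴ * Φ) * (U * Uᴴ * Φ)ᴴ = Φ * Φᴴ := by rw [hP]
    rw [← h2]
    simp only [Matrix.conjTranspose_mul, Matrix.conjTranspose_conjTranspose, Matrix.mul_assoc]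
  set G := Uᴴ * Φ * (Uᴴ * Φ)ᴴ
  have h3 : (Φ * Φᴴ).rank ≤ G.rank := by
    rw [← h1]
    exact (Matrix.rank_mul_le_left _ _).trans (Matrix.rank_mul_le_right _ _)
  rw [Matrix.rank_self_mul_conjTranspose] at h3
  have h4 : LinearMap.range G.mulVecLin = ⊤ := by
    apply Submodule.eq_top_of_finrank_eq
    apply le_antisymm (Submodule.finrank_le _)
    rw [Module.finrank_fin_fun]
    exact h3
  have h5 : IsUnit G := by
    rw [← Matrix.mulVec_surjective_iff_isUnit]
    exact LinearMap.range_eq_top.1 h4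
  exact ((Matrix.isUnit_iff_isUnit_det _).1 h5).ne_zero

end RangeProjection

/-! ### Normalisation and expectations of the m-DPP. -/

section MDPP

variable {ι : Type*} [Fintype ι] [DecidableEq ι]

omit [Fintype ι] in
theorem lWeight_eq (L : Matrix ι ι ℂ) (T : Finset ι) :
    lWeight L T = ENNReal.ofReal (minor L T).re := rfl

theorem lEnsemble_apply (L : Matrix ι ι ℂ) (A : Finset (Finset ι)) :
    lEnsemble L (A : Set (Finset ι)) = (∑ T, lWeight L T)⁻¹ * ∑ T ∈ A, lWeight L T := by
  classical
  have hA : MeasurableSet (A : Set (Finset ι)) := A.measurableSet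
  simp [lEnsemble, Measure.finsetSum_apply, hA, Set.indicator_apply, Finset.sum_ite_mem]

variable {L : Matrix ι ι ℂ} {m : ℕ} {d : ℝ} (hL : ∀ T, 0 ≤ (minor L T).re) (hd : 0 < d)
  (hsum : ∑ T : Finset ι with T.card = m, minor L T = d)

include hL hd hsum

omit hL hd in
theorem sum_re_minor : ∑ T : Finset ι with T.card = m, (minor L T).re = d := by
  have := congrArg Complex.re hsum
  simpa using this

omit hd in
theorem lEnsemble_card :
    lEnsemble L {T : Finset ι | T.card = m} =
      (∑ T, lWeight L T)⁻¹ * ENNReal.ofReal d := by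
  have h := lEnsemble_apply L (Finset.univ.filter fun T : Finset ι => T.card = m)
  rw [Finset.coe_filter_univ] at h
  rw [h]
  congr 1
  simp_rw [lWeight_eq]
  rw [← ENNReal.ofReal_sum_of_nonneg fun T _ => hL T, sum_re_minor hsum]

theorem sum_lWeight_ne_zero : ∑ T, lWeight L T ≠ 0 := by
  intro h
  have h1 : ∀ T, (minor L T).re = 0 := by
    intro T
    have := (Finset.sum_eq_zero_iff.1 h) T (Finset.mem_univ T)
    rw [lWeight_eq, ENNReal.ofReal_eq_zero] at this
    exact le_antisymm this (hL T)
  have := sum_re_minor hsum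
  simp [h1] at this
  exact hd.ne this

omit hL hd hsum in
theorem sum_lWeight_ne_top : ∑ T, lWeight L T ≠ ∞ := by
  simp [lWeight_eq]

theorem lEnsemble_card_ne_zero : lEnsemble L {T : Finset ι | T.card = m} ≠ 0 := by
  rw [lEnsemble_card hL hsum]
  simp [sum_lWeight_ne_top, hd, -ENNReal.sum_eq_top]

theorem lEnsemble_card_ne_top : lEnsemble L {T : Finset ι | T.card = m} ≠ ∞ := by
  rw [lEnsemble_card hL hsum]
  exact ENNReal.mul_ne_top (ENNReal.inv_ne_top.2 (sum_lWeight_ne_zero hL hd hsum))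
    ENNReal.ofReal_ne_top

theorem isProbabilityMeasure_mDPP : IsProbabilityMeasure (mDPP L m) := by
  refine cond_isProbabilityMeasure_of_finite (lEnsemble_card_ne_zero hL hd hsum)
    (lEnsemble_card_ne_top hL hd hsum)

/-- The constant of the L-ensemble cancels in the conditioning; only the sum d of the minors of
order m survives. -/
theorem mDPP_real_singleton (T : Finset ι) :
    (mDPP L m).real {T} = if T.card = m then d⁻¹ * (minor L T).re else 0 := by
  have hA : MeasurableSet {T : Finset ι | T.card = m} := Set.Finite.measurableSet (Set.toFinite _)
  rw [mDPP, measureReal_def, cond_apply hA]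
  split_ifs with h
  · have h1 : {T : Finset ι | T.card = m} ∩ {T} = {T} := by
      ext; simp +contextual [h]
    have h2 := lEnsemble_apply L {T}
    rw [Finset.coe_singleton, Finset.sum_singleton] at h2
    rw [h1, lEnsemble_card hL hsum, h2, lWeight_eq]
    have hZ : (∑ T, lWeight L T).toReal ≠ 0 := ENNReal.toReal_ne_zero.2
      ⟨sum_lWeight_ne_zero hL hd hsum, sum_lWeight_ne_top⟩
    simp only [ENNReal.toReal_mul, ENNReal.toReal_inv, ENNReal.toReal_ofReal hd.le,
      ENNReal.toReal_ofReal (hL T)]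
    field_simp
  · have h1 : {T : Finset ι | T.card = m} ∩ {T} = ∅ := by
      ext S
      simp only [Set.mem_inter_iff, Set.mem_ofPred_eq, Set.mem_singleton_iff, Set.mem_empty_iff_false,
        iff_false, not_and]
      rintro hS rfl
      exact h hS
    simp [h1]

theorem integral_mDPP (g : Finset ι → ℝ) :
    ∫ T, g T ∂(mDPP L m) = d⁻¹ * ∑ T : Finset ι with T.card = m, g T * (minor L T).re := by
  have := isProbabilityMeasure_mDPP hL hd hsum
  rw [integral_fintype .of_finite, Finset.mul_sum, Finset.sum_filter]
  refine Finset.sum_congr rfl fun T _ => ?_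
  rw [mDPP_real_singleton hL hd hsum]
  split_ifs <;> simp
  ring

/-- Almost surely, a sample of the `m`-DPP has a nonzero minor. -/
theorem ae_mDPP_minor_ne_zero : ∀ᵐ T ∂(mDPP L m), minor L T ≠ 0 := by
  have := isProbabilityMeasure_mDPP hL hd hsum
  have h : ∀ T : Finset ι, minor L T = 0 → mDPP L m {T} = 0 := by
    intro T hT
    have h1 := mDPP_real_singleton hL hd hsum T
    rw [hT] at h1
    simpa [measureReal_def, ENNReal.toReal_eq_zero_iff] using h1
  rw [ae_iff]
  have h2 : {T | ¬ minor L T ≠ 0} = ⋃ T ∈ {T : Finset ι | minor L T = 0}, {T} := by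
    ext; simp
  rw [h2, measure_biUnion_null_iff (Set.to_countable _)]
  exact fun T hT => h T hT

end MDPP

/-! ### Variance of a linear statistic of the m-DPP. -/

section Variance

variable {ι : Type*} [Fintype ι] [DecidableEq ι]

theorem minor_re_nonneg {n : ℕ} (Φ : Matrix ι (Fin n) ℂ) (T : Finset ι) :
    0 ≤ (minor (Φ * Φᴴ) T).re := by
  have h := ((Matrix.posSemidef_self_mul_conjTranspose Φ).submatrix (fun i : T => (i : ι))).det_nonneg
  exact (Complex.le_def.1 h).1

omit [DecidableEq ι] in
-- For a Hermitian projection Pᵢᵢ = ∑ⱼ |Pᵢⱼ|², so the single sum is itself a double sum and the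
-- square completes. The resulting form has nonnegative terms and vanishes on the diagonal, which
-- permits entrywise comparison.
theorem sum_sq_mul_sub_sum_eq (P : Matrix ι ι ℂ) (hP : P.IsHermitian) (hPP : P * P = P)
    (f : ι → ℝ) :
    (∑ i, f i ^ 2 * (P i i).re) - ∑ i, ∑ j, f i * f j * ‖P i j‖ ^ 2 =
      1 / 2 * ∑ i, ∑ j, (f i - f j) ^ 2 * ‖P i j‖ ^ 2 := by
  have hn : ∀ i j, ‖P i j‖ = ‖P j i‖ := by
    intro i j
    rw [← hP.apply i j, norm_star]
  have hd : ∀ i, (P i i).re = ∑ j, ‖P i j‖ ^ 2 := by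
    intro i
    have h1 : P i i = ∑ j, ((‖P i j‖ ^ 2 : ℝ) : ℂ) := by
      conv_lhs => rw [← hPP, Matrix.mul_apply]
      refine Finset.sum_congr rfl fun j _ => ?_
      rw [← hP.apply j i, Complex.star_def, Complex.mul_conj, Complex.normSq_eq_norm_sq]
    rw [h1, ← Complex.ofReal_sum, Complex.ofReal_re]
  have h2 : ∑ i, ∑ j, f j ^ 2 * ‖P i j‖ ^ 2 = ∑ i, ∑ j, f i ^ 2 * ‖P i j‖ ^ 2 := by
    rw [Finset.sum_comm]
    exact Finset.sum_congr rfl fun i _ => Finset.sum_congr rfl fun j _ => by rw [hn]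
  have h3 : ∀ i j, (f i - f j) ^ 2 * ‖P i j‖ ^ 2 = f i ^ 2 * ‖P i j‖ ^ 2 + f j ^ 2 * ‖P i j‖ ^ 2
      - 2 * (f i * f j * ‖P i j‖ ^ 2) := by
    intro i j; ring
  simp_rw [h3, Finset.sum_sub_distrib, Finset.sum_add_distrib, h2, hd, ← Finset.mul_sum]
  ring

/-- The variance of a linear statistic of the `m`-DPP of `Φ Φ*`, `m = rank Φ`, in terms of the
orthogonal projection onto the column space of `Φ`. -/
theorem variance_sum_mDPP {n : ℕ} (Φ : Matrix ι (Fin n) ℂ) {m : ℕ} (hm : Φ.rank = m)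
    (U : Matrix ι (Fin m) ℂ) (hU : Uᴴ * U = 1) (hP : U * Uᴴ * Φ = Φ) (f : ι → ℝ) :
    variance (fun T : Finset ι => ∑ i ∈ T, f i) (mDPP (Φ * Φᴴ) m) =
      1 / 2 * ∑ i, ∑ j, (f i - f j) ^ 2 * ‖(U * Uᴴ) i j‖ ^ 2 ∧
    ∀ᵐ T ∂(mDPP (Φ * Φᴴ) m), minor (Φ * Φᴴ) T ≠ 0 := by
  set G := Uᴴ * Φ * (Uᴴ * Φ)ᴴ with hG
  have h1 : U * G * Uᴴ = Φ * Φᴴ := by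
    have h2 : (U * Uᴴ * Φ) * (U * Uᴴ * Φ)ᴴ = Φ * Φᴴ := by rw [hP]
    rw [← h2, hG]
    simp only [Matrix.conjTranspose_mul, Matrix.conjTranspose_conjTranspose, Matrix.mul_assoc]
  have hdet : G.det ≠ 0 := by
    subst hm
    exact det_compression_ne_zero Φ U hP
  have hdet0 : 0 ≤ G.det := (Matrix.posSemidef_self_mul_conjTranspose (Uᴴ * Φ)).det_nonneg
  obtain ⟨d, hd⟩ : ∃ d : ℝ, G.det = d := ⟨G.det.re, by
    apply Complex.ext <;> simp [(Complex.le_def.1 hdet0).2.symm]⟩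
  have hdpos : 0 < d := by
    rw [hd] at hdet hdet0
    exact lt_of_le_of_ne (by exact_mod_cast hdet0) (fun h => hdet (by simp [← h]))
  have hL := minor_re_nonneg Φ
  have hsum : ∑ T : Finset ι with T.card = m, minor (Φ * Φᴴ) T = d := by
    rw [← h1, sum_minor U G hU, hd]
  have hprob := isProbabilityMeasure_mDPP hL hdpos hsum
  refine ⟨?_, ae_mDPP_minor_ne_zero hL hdpos hsum⟩
  set P := U * Uᴴ with hPdef
  have hPH : P.IsHermitian := Matrix.isHermitian_mul_conjTranspose_self U
  have hPP : P * P = P := by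
    rw [hPdef, Matrix.mul_assoc, ← Matrix.mul_assoc Uᴴ, hU, Matrix.one_mul]
  have hmem : ∀ i, ∑ T : Finset ι with T.card = m,
      (if i ∈ T then 1 else 0) * (minor (Φ * Φᴴ) T).re = d * (P i i).re := by
    intro i
    have := congrArg Complex.re (sum_minor_mem U G hU i)
    rw [h1, hd, Complex.re_ofReal_mul, Complex.re_sum] at this
    rw [← this]
    refine Finset.sum_congr rfl fun T _ => ?_
    split_ifs <;> simp
  -- For i = j the first two terms cancel, as Pᵢᵢ is real, and Pᵢᵢ remains; for i ≠ j the bracket is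
  -- the 2 × 2 minor of P.
  have hmem2 : ∀ i j, ∑ T : Finset ι with T.card = m,
      ((if i ∈ T then 1 else 0) * (if j ∈ T then 1 else 0)) * (minor (Φ * Φᴴ) T).re =
      d * ((P i i).re * (P j j).re - ‖P i j‖ ^ 2 + if i = j then (P i i).re else 0) := by
    intro i j
    have him : ∀ i, P i i = ((P i i).re : ℂ) := fun i => (hPH.coe_re_apply_self i).symm
    by_cases hij : i = j
    · subst hij
      have h2 : ‖P i i‖ ^ 2 = (P i i).re * (P i i).re := by
        conv_lhs => rw [him i]
        rw [Complex.norm_real, Real.norm_eq_abs, sq_abs, sq]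
      rw [h2]
      simp only [if_true, sub_self, zero_add]
      rw [← hmem]
      refine Finset.sum_congr rfl fun T _ => ?_
      split_ifs <;> simp
    · have := congrArg Complex.re (sum_minor_mem_mem U G hU hij)
      have h2 : P i j * P j i = ((‖P i j‖ ^ 2 : ℝ) : ℂ) := by
        rw [← hPH.apply j i, Complex.star_def, Complex.mul_conj, Complex.normSq_eq_norm_sq]
      rw [h1, hd, Complex.re_ofReal_mul, Complex.re_sum, ← hPdef, h2, him i, him j, ← Complex.ofReal_mul,
        ← Complex.ofReal_sub, Complex.ofReal_re] at this
      simp only [hij, if_false, add_zero]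
      rw [← this]
      refine Finset.sum_congr rfl fun T _ => ?_
      split_ifs <;> simp
  have hX : ∀ T : Finset ι, ∑ i ∈ T, f i = ∑ i, f i * (if i ∈ T then 1 else 0) := by
    intro T; simp
  have hE : ∫ T, ∑ i ∈ T, f i ∂(mDPP (Φ * Φᴴ) m) = ∑ i, f i * (P i i).re := by
    rw [integral_mDPP hL hdpos hsum]
    simp_rw [hX, Finset.sum_mul]
    rw [Finset.sum_comm, Finset.mul_sum]
    refine Finset.sum_congr rfl fun i _ => ?_
    simp_rw [mul_assoc, ← Finset.mul_sum, hmem]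
    field_simp
  have hE2 : ∫ T, (∑ i ∈ T, f i) ^ 2 ∂(mDPP (Φ * Φᴴ) m) =
      ∑ i, ∑ j, f i * f j * ((P i i).re * (P j j).re - ‖P i j‖ ^ 2 +
        if i = j then (P i i).re else 0) := by
    rw [integral_mDPP hL hdpos hsum]
    have h3 : ∀ T : Finset ι, (∑ i ∈ T, f i) ^ 2 * (minor (Φ * Φᴴ) T).re =
        ∑ i, ∑ j, f i * f j * (((if i ∈ T then 1 else 0) * (if j ∈ T then 1 else 0)) *
          (minor (Φ * Φᴴ) T).re) := by
      intro T
      rw [hX, sq, Finset.sum_mul_sum, Finset.sum_mul]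
      refine Finset.sum_congr rfl fun i _ => ?_
      rw [Finset.sum_mul]
      refine Finset.sum_congr rfl fun j _ => ?_
      ring
    simp_rw [h3]
    rw [Finset.sum_comm, Finset.mul_sum]
    refine Finset.sum_congr rfl fun i _ => ?_
    rw [Finset.sum_comm, Finset.mul_sum]
    refine Finset.sum_congr rfl fun j _ => ?_
    rw [← Finset.mul_sum, hmem2]
    field_simp
  have hvar := variance_eq_sub (μ := mDPP (Φ * Φᴴ) m) (X := fun T : Finset ι => ∑ i ∈ T, f i)
    MemLp.of_discrete
  rw [hvar, ← sum_sq_mul_sub_sum_eq P hPH hPP f]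
  have hE2' : (mDPP (Φ * Φᴴ) m)[(fun T : Finset ι => ∑ i ∈ T, f i) ^ 2] =
    ∫ T, (∑ i ∈ T, f i) ^ 2 ∂(mDPP (Φ * Φᴴ) m) := rfl
  rw [hE2', hE2, hE, sq (∑ i, f i * (P i i).re), Finset.sum_mul_sum, ← Finset.sum_sub_distrib,
    ← Finset.sum_sub_distrib]
  refine Finset.sum_congr rfl fun i _ => ?_
  rw [← Finset.sum_sub_distrib]
  have h4 : ∀ j, f i * f j * ((P i i).re * (P j j).re - ‖P i j‖ ^ 2 +
        if i = j then (P i i).re else 0) - f i * (P i i).re * (f j * (P j j).re) =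
      (if i = j then f i * f j * (P i i).re else 0) - f i * f j * ‖P i j‖ ^ 2 := by
    intro j; split_ifs <;> ring
  simp_rw [h4, Finset.sum_sub_distrib]
  simp only [Finset.sum_ite_eq, Finset.mem_univ, if_true]
  ring

end Variance

end DiscreteDPP

/-! ### Replacing the projection by L in Frobenius norm. -/

section Sandwich

variable {ι : Type*} [Fintype ι]

theorem sum_norm_sq_eq_trace (A : Matrix ι ι ℂ) (hA : A.IsHermitian) :
    ((∑ i, ∑ j, ‖A i j‖ ^ 2 : ℝ) : ℂ) = (A * A).trace := by
  simp only [Matrix.trace, Matrix.diag, Matrix.mul_apply]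
  push_cast
  refine Finset.sum_congr rfl fun i _ => Finset.sum_congr rfl fun j _ => ?_
  rw [← hA.apply j i, Complex.star_def, Complex.mul_conj, Complex.normSq_eq_norm_sq]
  push_cast
  rfl

/-- The projection onto the column space of `Φ` is at least as close to `Φ Φ*` as the identity is
to `Φ* Φ`, in Frobenius norm. -/
theorem sum_norm_projection_sub_sq_le [DecidableEq ι] {n : ℕ} (Φ : Matrix ι (Fin n) ℂ) {m : ℕ}
    (hm : Φ.rank = m) (U : Matrix ι (Fin m) ℂ) (hU : Uᴴ * U = 1) (hP : U * Uᴴ * Φ = Φ) :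
    ∑ i, ∑ j, ‖(U * Uᴴ - Φ * Φᴴ) i j‖ ^ 2 ≤ ∑ k, ∑ l, ‖(Φᴴ * Φ - 1 : Matrix (Fin n) (Fin n) ℂ) k l‖ ^ 2 := by
  set P := U * Uᴴ with hPdef
  have hPH : P.IsHermitian := Matrix.isHermitian_mul_conjTranspose_self U
  have hLH : (Φ * Φᴴ).IsHermitian := Matrix.isHermitian_mul_conjTranspose_self Φ
  have hSH : (Φᴴ * Φ).IsHermitian := Matrix.isHermitian_conjTranspose_mul_self Φ
  have h1 := sum_norm_sq_eq_trace _ (hPH.sub hLH)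
  have h2 := sum_norm_sq_eq_trace _ (hSH.sub Matrix.isHermitian_one)
  have hPP : P * P = P := by
    rw [hPdef, Matrix.mul_assoc, ← Matrix.mul_assoc Uᴴ, hU, Matrix.one_mul]
  have hPL : P * (Φ * Φᴴ) = Φ * Φᴴ := by rw [← Matrix.mul_assoc, hP]
  have hLP : Φ * Φᴴ * P = Φ * Φᴴ := by
    have := congrArg Matrix.conjTranspose hPL
    rwa [Matrix.conjTranspose_mul, hLH.eq, hPH.eq] at this
  have htP : P.trace = (m : ℂ) := by
    rw [hPdef, Matrix.trace_mul_comm, hU, Matrix.trace_one, Fintype.card_fin]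
  -- P fixes ΦΦ* on both sides and has trace m; cyclicity moves the other traces to Φ*Φ.
  have h3 : ((P - Φ * Φᴴ) * (P - Φ * Φᴴ)).trace =
      m - 2 * (Φᴴ * Φ).trace + (Φᴴ * Φ * (Φᴴ * Φ)).trace := by
    have : (Φ * Φᴴ * (Φ * Φᴴ)).trace = (Φᴴ * Φ * (Φᴴ * Φ)).trace := by
      rw [Matrix.mul_assoc, Matrix.trace_mul_comm]
      simp only [Matrix.mul_assoc]
    rw [Matrix.sub_mul, Matrix.mul_sub, Matrix.mul_sub, hPP, hPL, hLP]
    simp only [Matrix.trace_sub]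
    rw [htP, this, Matrix.trace_mul_comm Φ]
    ring
  have h4 : ((Φᴴ * Φ - 1) * (Φᴴ * Φ - 1)).trace =
      n - 2 * (Φᴴ * Φ).trace + (Φᴴ * Φ * (Φᴴ * Φ)).trace := by
    rw [Matrix.sub_mul, Matrix.mul_sub, Matrix.mul_sub]
    simp only [Matrix.trace_sub, Matrix.one_mul, Matrix.mul_one, Matrix.trace_one, Fintype.card_fin]
    ring
  -- The two squared norms differ by exactly n − m: each zero eigenvalue of Φ*Φ costs 1 against the
  -- identity and nothing against P.
  have h5 : ((∑ k, ∑ l, ‖(Φᴴ * Φ - 1 : Matrix (Fin n) (Fin n) ℂ) k l‖ ^ 2 : ℝ) : ℂ) -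
      ((∑ i, ∑ j, ‖(P - Φ * Φᴴ) i j‖ ^ 2 : ℝ) : ℂ) = (((n : ℝ) - m : ℝ) : ℂ) := by
    rw [h1, h2, h3, h4]; push_cast; ring
  have h6 : (∑ k, ∑ l, ‖(Φᴴ * Φ - 1 : Matrix (Fin n) (Fin n) ℂ) k l‖ ^ 2) -
      (∑ i, ∑ j, ‖(P - Φ * Φᴴ) i j‖ ^ 2) = (n : ℝ) - m := by exact_mod_cast h5
  have h7 : m ≤ n := by
    rw [← hm]
    simpa using Matrix.rank_le_card_width Φ
  have h8 : (m : ℝ) ≤ n := by exact_mod_cast h7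
  linarith

/-- Comparison of quadratic forms in the entries of two matrices. -/
theorem sum_sub_sq_mul_norm_sq_le (A B : Matrix ι ι ℂ) (f : ι → ℝ) {C : ℝ}
    (hf : ∀ i, |f i| ≤ C) :
    1 / 2 * ∑ i, ∑ j, (f i - f j) ^ 2 * ‖A i j‖ ^ 2 ≤
      2 * (1 / 2 * ∑ i, ∑ j, (f i - f j) ^ 2 * ‖B i j‖ ^ 2) +
        4 * C ^ 2 * ∑ i, ∑ j, ‖(A - B) i j‖ ^ 2 := by
  simp_rw [Finset.mul_sum, ← Finset.sum_add_distrib]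
  refine Finset.sum_le_sum fun i _ => Finset.sum_le_sum fun j _ => ?_
  have h1 : (f i - f j) ^ 2 ≤ 4 * C ^ 2 := by
    have hi := abs_le.1 (hf i)
    have hj := abs_le.1 (hf j)
    have : |f i - f j| ≤ 2 * C := by rw [abs_le]; constructor <;> linarith
    nlinarith [sq_abs (f i - f j), abs_nonneg (f i - f j)]
  -- The constant 4C² of the conclusion is ½ · 4C² · 2.
  have h2 : ‖A i j‖ ^ 2 ≤ 2 * ‖B i j‖ ^ 2 + 2 * ‖(A - B) i j‖ ^ 2 := by
    have h3 : ‖A i j‖ ≤ ‖B i j‖ + ‖(A - B) i j‖ := by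
      have := norm_add_le (B i j) ((A - B) i j)
      simpa using this
    nlinarith [norm_nonneg (A i j), sq_nonneg (‖B i j‖ - ‖(A - B) i j‖)]
  have h3 := mul_le_mul_of_nonneg_left h2 (sq_nonneg (f i - f j))
  have h4 := mul_le_mul_of_nonneg_right h1 (sq_nonneg ‖(A - B) i j‖)
  nlinarith

end Sandwich

/-! ### Deterministic bounds on the conditional variance. -/

section DiscreteVar

variable {E : Type*} {n N : ℕ} (ψ : Fin n → E → ℂ) (ρ : E → ℝ) (f : E → ℝ) (x : Fin N → E)

/-- The normalised feature matrix `N^{-1/2} D(ρ^{-1/2}) Ψ`. -/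
noncomputable def whitenedMatrix : Matrix (Fin N) (Fin n) ℂ :=
  Matrix.of fun i k => (((√N)⁻¹ * (√(ρ (x i)))⁻¹ : ℝ) : ℂ) * ψ k (x i)

theorem whitenedMatrix_eq : whitenedMatrix ψ ρ x =
    (((√N)⁻¹ : ℝ) : ℂ) • (invSqrtDiag ρ x * featureMatrix ψ x) := by
  ext i k
  simp [whitenedMatrix, invSqrtDiag, featureMatrix, Matrix.diagonal_mul, mul_assoc]

theorem lMatrix_eq : lMatrix ψ ρ x = whitenedMatrix ψ ρ x * (whitenedMatrix ψ ρ x)ᴴ := by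
  have hD : (invSqrtDiag ρ x)ᴴ = invSqrtDiag ρ x := by
    simp [invSqrtDiag, Matrix.diagonal_conjTranspose, Pi.star_def]
  rw [whitenedMatrix_eq, lMatrix, Matrix.conjTranspose_smul, Matrix.conjTranspose_mul, hD,
    Matrix.smul_mul, Matrix.mul_smul, smul_smul, Complex.star_def, Complex.conj_ofReal,
    ← Complex.ofReal_mul, ← mul_inv, Real.mul_self_sqrt (Nat.cast_nonneg N)]
  simp [Matrix.mul_assoc]

theorem rank_whitenedMatrix (hN : 1 ≤ N) (hρ : ∀ i, 0 < ρ (x i)) :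
    (whitenedMatrix ψ ρ x).rank = (featureMatrix ψ x).rank := by
  have h : whitenedMatrix ψ ρ x =
      ((((√N)⁻¹ : ℝ) : ℂ) • invSqrtDiag ρ x) * featureMatrix ψ x := by
    rw [whitenedMatrix_eq, Matrix.smul_mul]
  rw [h]
  apply Matrix.rank_mul_eq_right_of_isUnit_det
  rw [Matrix.det_smul, invSqrtDiag, Matrix.det_diagonal]
  refine IsUnit.mk0 _ (mul_ne_zero (pow_ne_zero _ ?_) (Finset.prod_ne_zero_iff.2 fun i _ => ?_))
  · have : (0 : ℝ) < N := by exact_mod_cast hN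
    exact Complex.ofReal_ne_zero.2 (inv_ne_zero (Real.sqrt_ne_zero'.2 this))
  · exact Complex.ofReal_ne_zero.2 (inv_ne_zero (Real.sqrt_ne_zero'.2 (hρ i)))

/-- A subset on which the data points are not distinct has zero minor. -/
theorem injOn_of_minor_ne_zero {T : Finset (Fin N)}
    (hT : minor (lMatrix ψ ρ x) T ≠ 0) : Set.InjOn x T := by
  intro i hi j hj hij
  by_contra hne
  apply hT
  rw [lMatrix_eq]
  refine Matrix.det_zero_of_row_eq (i := ⟨i, hi⟩) (j := ⟨j, hj⟩) (by simpa using hne) ?_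
  ext k
  simp [Matrix.mul_apply, whitenedMatrix, hij]

/-- A repeated data point would count once on the left and several times on the right. Index sets
with repetitions have zero minor, so the m-DPP almost surely avoids them. -/
theorem linStat_image_eq_sum {T : Finset (Fin N)} (hT : Set.InjOn x T) :
    linStat f (x '' (T : Set (Fin N))) = ∑ i ∈ T, f (x i) := by
  rw [linStat, ← (Equiv.Set.imageOfInjOn x (T : Set (Fin N)) hT).tsum_eq]
  rw [tsum_fintype, ← Finset.sum_coe_sort T]
  rfl

/-- The discrete variance functional with the projection replaced by `L`. -/
noncomputable def empiricalVar : ℝ :=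
  1 / 2 * ∑ i, ∑ j, (f (x i) - f (x j)) ^ 2 * ‖lMatrix ψ ρ x i j‖ ^ 2

/-- The squared Frobenius distance of the empirical Gram matrix to the identity. -/
noncomputable def gramError : ℝ :=
  ∑ k, ∑ l, ‖((whitenedMatrix ψ ρ x)ᴴ * whitenedMatrix ψ ρ x - 1 : Matrix (Fin n) (Fin n) ℂ) k l‖ ^ 2

/-- The comparison of quadratic forms is applied to (P, L) and to (L, P); halving the second gives
the lower bound. The Gram error dominates the Frobenius distance in both. -/
theorem discreteVar_bounds (hN : 1 ≤ N) (hρ : ∀ i, 0 < ρ (x i)) {C : ℝ} (hf : ∀ y, |f y| ≤ C) :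
    discreteVar ψ ρ f x ≤ 2 * empiricalVar ψ ρ f x + 4 * C ^ 2 * gramError ψ ρ x ∧
    empiricalVar ψ ρ f x / 2 - 2 * C ^ 2 * gramError ψ ρ x ≤ discreteVar ψ ρ f x := by
  set Φ := whitenedMatrix ψ ρ x with hΦ
  have hrank := rank_whitenedMatrix ψ ρ x hN hρ
  obtain ⟨U, hU, hP⟩ := exists_orthonormal_columns Φ
  obtain ⟨hvar, hae⟩ := variance_sum_mDPP Φ rfl U hU hP (fun i => f (x i))
  have hL := lMatrix_eq ψ ρ x
  rw [← hΦ] at hL hrank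
  have hdv : discreteVar ψ ρ f x =
      1 / 2 * ∑ i, ∑ j, (f (x i) - f (x j)) ^ 2 * ‖(U * Uᴴ) i j‖ ^ 2 := by
    rw [← hvar, discreteVar, ← hrank, hL]
    refine variance_congr ?_
    filter_upwards [hae] with T hT
    rw [← hL] at hT
    exact linStat_image_eq_sum f x (injOn_of_minor_ne_zero ψ ρ x hT)
  have hg : ∑ i, ∑ j, ‖(U * Uᴴ - Φ * Φᴴ) i j‖ ^ 2 ≤ gramError ψ ρ x :=
    sum_norm_projection_sub_sq_le Φ rfl U hU hP
  have h1 := sum_sub_sq_mul_norm_sq_le (U * Uᴴ) (Φ * Φᴴ) (fun i => f (x i)) (fun i => hf (x i))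
  have h2 := sum_sub_sq_mul_norm_sq_le (Φ * Φᴴ) (U * Uᴴ) (fun i => f (x i)) (fun i => hf (x i))
  have h3 : ∑ i, ∑ j, ‖(Φ * Φᴴ - U * Uᴴ) i j‖ ^ 2 = ∑ i, ∑ j, ‖(U * Uᴴ - Φ * Φᴴ) i j‖ ^ 2 := by
    refine Finset.sum_congr rfl fun i _ => Finset.sum_congr rfl fun j _ => ?_
    rw [Matrix.sub_apply, Matrix.sub_apply, norm_sub_rev]
  rw [h3] at h2
  have h4 : empiricalVar ψ ρ f x =
      1 / 2 * ∑ i, ∑ j, (f (x i) - f (x j)) ^ 2 * ‖(Φ * Φᴴ) i j‖ ^ 2 := by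
    rw [empiricalVar, hL]
  rw [hdv, h4]
  have h5 := mul_le_mul_of_nonneg_left hg (by positivity : (0 : ℝ) ≤ 4 * C ^ 2)
  constructor <;> linarith

end DiscreteVar

/-! ### McDiarmid's inequality. -/

section BoundedDifferences

variable {E : Type*} [MeasurableSpace E] (ν : Measure E) [IsProbabilityMeasure ν]

omit [IsProbabilityMeasure ν] in
theorem integrable_of_abs_le [IsFiniteMeasure ν] {g : E → ℝ} (hg : Measurable g) {C : ℝ}
    (hC : ∀ x, |g x| ≤ C) : Integrable g ν :=
  Integrable.of_bound hg.aestronglyMeasurable C (Filter.Eventually.of_forall hC)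

/-- Hoeffding's lemma for a function of oscillation at most `c`. -/
theorem integral_exp_le_of_oscillation {g : E → ℝ} (hg : Measurable g) {c : ℝ}
    (hc : ∀ x y, |g x - g y| ≤ c) (t : ℝ) :
    ∫ x, Real.exp (t * (g x - ∫ y, g y ∂ν)) ∂ν ≤ Real.exp (c ^ 2 * t ^ 2 / 8) := by
  have hne : Nonempty E := ν.nonempty_of_neZero
  let x0 : E := hne.some
  have hbdd : BddBelow (Set.range g) := ⟨g x0 - c, by
    rintro _ ⟨y, rfl⟩
    have := (abs_le.1 (hc x0 y)).2
    linarith⟩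
  have hIcc : ∀ x, g x ∈ Set.Icc (⨅ y, g y) ((⨅ y, g y) + c) := by
    intro x
    refine ⟨ciInf_le hbdd x, ?_⟩
    have : g x - c ≤ ⨅ y, g y := le_ciInf fun y => by
      have := (abs_le.1 (hc x y)).2
      linarith
    linarith
  have h := (hasSubgaussianMGF_of_mem_Icc (μ := ν) hg.aemeasurable
    (Filter.Eventually.of_forall hIcc)).mgf_le t
  rw [mgf] at h
  refine h.trans (Real.exp_le_exp.2 (le_of_eq ?_))
  push_cast
  rw [add_sub_cancel_left, Real.norm_eq_abs, div_pow, sq_abs]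
  ring

/-- Induction on the number of coordinates: with the first one frozen at a, the induction hypothesis
bounds the exponential moment around the conditional mean g(a). Then g oscillates by at most c and
Hoeffding's lemma applies to it; the exponents add up. The bound C serves integrability only. -/
theorem integral_exp_le_of_bounded_differences {c : ℝ} (N : ℕ) (F : (Fin N → E) → ℝ)
    (hF : Measurable F) {C : ℝ} (hC : ∀ x, |F x| ≤ C)
    (hc : ∀ x i y, |F x - F (Function.update x i y)| ≤ c) (t : ℝ) :
    ∫ x, Real.exp (t * (F x - ∫ y, F y ∂(Measure.pi fun _ => ν))) ∂(Measure.pi fun _ => ν) ≤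
      Real.exp (N * c ^ 2 * t ^ 2 / 8) := by
  induction N with
  | zero =>
    have h : ∀ x, F x = F default := fun x => by rw [Subsingleton.elim x default]
    simp [h]
  | succ N ih =>
    let e := MeasurableEquiv.piFinSuccAbove (fun _ : Fin (N + 1) => E) 0
    have he : MeasurePreserving e.symm (ν.prod (Measure.pi fun _ => ν))
        (Measure.pi fun _ => ν) :=
      (measurePreserving_piFinSuccAbove (fun _ : Fin (N + 1) => ν) 0).symm
    let G : E × (Fin N → E) → ℝ := fun p => F (e.symm p)
    have hG : Measurable G := hF.comp e.symm.measurable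
    have hGC : ∀ p, |G p| ≤ C := fun p => hC _
    have hes : ∀ a x, e.symm (a, x) = (Fin.cons a x : Fin (N + 1) → E) := fun a x => by
      simp [e, MeasurableEquiv.piFinSuccAbove_symm_apply, Fin.insertNthEquiv]
    let g : E → ℝ := fun a => ∫ x, G (a, x) ∂(Measure.pi fun _ => ν)
    have hg : Measurable g := hG.stronglyMeasurable.integral_prod_right.measurable
    have hGa : ∀ a, Integrable (fun x => G (a, x)) (Measure.pi fun _ => ν) := fun a =>
      integrable_of_abs_le _ (hG.comp measurable_prodMk_left) (fun x => hGC _)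
    have hgosc : ∀ a b, |g a - g b| ≤ c := by
      intro a b
      have h1 : g a - g b = ∫ x, (G (a, x) - G (b, x)) ∂(Measure.pi fun _ => ν) :=
        (integral_sub (hGa a) (hGa b)).symm
      rw [h1]
      have h2 := norm_integral_le_of_norm_le_const (μ := Measure.pi fun _ : Fin N => ν)
        (f := fun x => G (a, x) - G (b, x)) (C := c) (Filter.Eventually.of_forall fun x => by
          have := hc (Fin.cons a x) 0 b
          rw [Fin.update_cons_zero] at this
          simpa [G, hes] using this)
      simpa using h2
    have hint : ∫ y, F y ∂(Measure.pi fun _ => ν) = ∫ a, g a ∂ν := by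
      rw [← he.integral_comp' (g := F)]
      exact integral_prod _ (integrable_of_abs_le _ hG hGC)
    rw [hint, ← he.integral_comp' (g := fun x => Real.exp (t * (F x - ∫ a, g a ∂ν)))]
    set M := ∫ a, g a ∂ν
    have hM : ∀ p, Real.exp (t * (G p - M)) ≤ Real.exp (|t| * (C + |M|)) := by
      intro p
      apply Real.exp_le_exp.2
      calc t * (G p - M) ≤ |t * (G p - M)| := le_abs_self _
        _ = |t| * |G p - M| := abs_mul _ _
        _ ≤ |t| * (C + |M|) := by
          gcongr
          exact (abs_sub _ _).trans (by linarith [hGC p])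
    have hmeas : Measurable fun p => Real.exp (t * (G p - M)) := by fun_prop
    have hgC : ∀ a, |g a| ≤ C := fun a => by
      have := norm_integral_le_of_norm_le_const (μ := Measure.pi fun _ : Fin N => ν)
        (f := fun x => G (a, x)) (C := C) (Filter.Eventually.of_forall fun x => hGC _)
      simpa using this
    have hstep : ∀ a, ∫ x, Real.exp (t * (G (a, x) - M)) ∂(Measure.pi fun _ => ν) ≤
        Real.exp (t * (g a - M)) * Real.exp (N * c ^ 2 * t ^ 2 / 8) := by
      intro a
      have h1 := ih (fun x => G (a, x)) (hG.comp measurable_prodMk_left) (fun x => hGC _)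
        (fun x i y => by
          have := hc (Fin.cons a x) i.succ y
          rw [← Fin.cons_update] at this
          simpa [G, hes] using this)
      have h2 : ∀ x, Real.exp (t * (G (a, x) - M)) =
          Real.exp (t * (g a - M)) * Real.exp (t * (G (a, x) - g a)) := by
        intro x; rw [← Real.exp_add]; ring_nf
      simp_rw [h2]
      rw [integral_const_mul]
      exact mul_le_mul_of_nonneg_left h1 (Real.exp_pos _).le
    calc ∫ p, Real.exp (t * (G p - M)) ∂(ν.prod (Measure.pi fun _ => ν))
        = ∫ a, ∫ x, Real.exp (t * (G (a, x) - M)) ∂(Measure.pi fun _ => ν) ∂ν :=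
          integral_prod _ (integrable_of_abs_le _ hmeas fun p => by
            rw [abs_of_pos (Real.exp_pos _)]; exact hM p)
      _ ≤ ∫ a, Real.exp (t * (g a - M)) * Real.exp (N * c ^ 2 * t ^ 2 / 8) ∂ν := by
          refine integral_mono_of_nonneg (Filter.Eventually.of_forall fun a =>
            integral_nonneg fun x => (Real.exp_pos _).le) ?_ (Filter.Eventually.of_forall hstep)
          refine Integrable.mul_const ?_ _
          refine integrable_of_abs_le _ (by fun_prop) (C := Real.exp (|t| * (C + |M|))) fun a => ?_
          rw [abs_of_pos (Real.exp_pos _)]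
          apply Real.exp_le_exp.2
          calc t * (g a - M) ≤ |t * (g a - M)| := le_abs_self _
            _ = |t| * |g a - M| := abs_mul _ _
            _ ≤ |t| * (C + |M|) := by
              gcongr
              exact (abs_sub _ _).trans (by linarith [hgC a])
      _ = (∫ a, Real.exp (t * (g a - M)) ∂ν) * Real.exp (N * c ^ 2 * t ^ 2 / 8) :=
          integral_mul_const _ _
      _ ≤ Real.exp (c ^ 2 * t ^ 2 / 8) * Real.exp (N * c ^ 2 * t ^ 2 / 8) :=
          mul_le_mul_of_nonneg_right (integral_exp_le_of_oscillation ν hg hgosc t)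
            (Real.exp_pos _).le
      _ = Real.exp ((N + 1 : ℕ) * c ^ 2 * t ^ 2 / 8) := by
          rw [← Real.exp_add]; push_cast; ring_nf

/-- McDiarmid's bounded differences inequality. -/
theorem measureReal_ge_le_of_bounded_differences {c : ℝ} (N : ℕ) (F : (Fin N → E) → ℝ)
    (hF : Measurable F) {C : ℝ} (hC : ∀ x, |F x| ≤ C)
    (hc : ∀ x i y, |F x - F (Function.update x i y)| ≤ c) {ε : ℝ} (hε : 0 ≤ ε) :
    (Measure.pi fun _ => ν).real {x | ε ≤ F x - ∫ y, F y ∂(Measure.pi fun _ => ν)} ≤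
      Real.exp (-(2 * ε ^ 2 / (N * c ^ 2))) := by
  set M := ∫ y, F y ∂(Measure.pi fun _ => ν)
  -- The variance proxy N c²/4 comes from N c² t²/8 = (N c²/4) t²/2.
  have hsub : HasSubgaussianMGF (fun x => F x - M) (Real.toNNReal (N * c ^ 2 / 4))
      (Measure.pi fun _ => ν) := by
    constructor
    · intro t
      refine integrable_of_abs_le _ (by fun_prop) (C := Real.exp (|t| * (C + |M|))) fun x => ?_
      rw [abs_of_pos (Real.exp_pos _)]
      apply Real.exp_le_exp.2
      calc t * (F x - M) ≤ |t * (F x - M)| := le_abs_self _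
        _ = |t| * |F x - M| := abs_mul _ _
        _ ≤ |t| * (C + |M|) := by
          gcongr
          exact (abs_sub _ _).trans (by linarith [hC x])
    · intro t
      refine (integral_exp_le_of_bounded_differences ν N F hF hC hc t).trans
        (Real.exp_le_exp.2 (le_of_eq ?_))
      rw [Real.coe_toNNReal _ (by positivity)]
      ring
  refine (hsub.measure_ge_le hε).trans (Real.exp_le_exp.2 (le_of_eq ?_))
  rw [Real.coe_toNNReal _ (by positivity), neg_div]
  congr 1
  rw [show 2 * (N * c ^ 2 / 4) = (N * c ^ 2) / 2 by ring, div_div_eq_mul_div]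
  ring

end BoundedDifferences

/-! ### The projection kernel and its reproducing property. -/

section Kernel

variable {E : Type*} {n : ℕ} (ψ : Fin n → E → ℂ)

/-- The diagonal `K(x, x)` of the projection kernel. -/
noncomputable def diagKernel (x : E) : ℝ := ∑ k, ‖ψ k x‖ ^ 2

theorem diagKernel_nonneg (x : E) : 0 ≤ diagKernel ψ x :=
  Finset.sum_nonneg fun _ _ => by positivity

theorem projKernel_self (x : E) : projKernel ψ x x = (diagKernel ψ x : ℂ) := by
  simp only [projKernel, diagKernel, Complex.mul_conj, Complex.normSq_eq_norm_sq]
  push_cast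
  rfl

theorem conj_projKernel (x y : E) : (starRingEnd ℂ) (projKernel ψ x y) = projKernel ψ y x := by
  simp [projKernel, mul_comm]

/-- Cauchy–Schwarz over k. It makes the two-point function nonnegative and |K|² integrable. -/
theorem norm_projKernel_sq_le (x y : E) :
    ‖projKernel ψ x y‖ ^ 2 ≤ diagKernel ψ x * diagKernel ψ y := by
  have h1 : ‖projKernel ψ x y‖ ≤ ∑ k, ‖ψ k x‖ * ‖ψ k y‖ := by
    refine (norm_sum_le _ _).trans (le_of_eq ?_)
    simp
  exact (pow_le_pow_left₀ (norm_nonneg _) h1 2).trans (Finset.sum_mul_sq_le_sq_mul_sq _ _ _)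

theorem kernelDet_one (x : Fin 1 → E) :
    (kernelDet (projKernel ψ) x).re = diagKernel ψ (x 0) := by
  rw [kernelDet, Matrix.det_fin_one, Matrix.of_apply, projKernel_self, Complex.ofReal_re]

theorem kernelDet_two (x : Fin 2 → E) :
    (kernelDet (projKernel ψ) x).re =
      diagKernel ψ (x 0) * diagKernel ψ (x 1) - ‖projKernel ψ (x 0) (x 1)‖ ^ 2 := by
  rw [kernelDet, Matrix.det_fin_two]
  simp only [Matrix.of_apply]
  rw [projKernel_self, projKernel_self, ← conj_projKernel ψ (x 0) (x 1), Complex.mul_conj,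
    Complex.normSq_eq_norm_sq, ← Complex.ofReal_mul, ← Complex.ofReal_sub, Complex.ofReal_re]

variable [MeasurableSpace E] {μ : Measure E} {ψ} (hψ_meas : ∀ k, Measurable (ψ k))
  (hψ_L2 : ∀ k, MemLp (ψ k) 2 μ) (hψ_orth : Orthonormal ℂ fun k => (hψ_L2 k).toLp (ψ k))

include hψ_meas in
theorem measurable_diagKernel : Measurable (diagKernel ψ) := by
  unfold diagKernel
  fun_prop

include hψ_meas in
theorem measurable_projKernel : Measurable fun p : E × E => projKernel ψ p.1 p.2 := by
  unfold projKernel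
  refine Finset.measurable_sum _ fun k _ => ?_
  exact ((hψ_meas k).comp measurable_fst).mul
    (Complex.continuous_conj.measurable.comp ((hψ_meas k).comp measurable_snd))

include hψ_L2 in
theorem integrable_conj_mul (k l : Fin n) :
    Integrable (fun y => (starRingEnd ℂ) (ψ k y) * ψ l y) μ := by
  refine (L2.integrable_inner (𝕜 := ℂ) ((hψ_L2 k).toLp (ψ k)) ((hψ_L2 l).toLp (ψ l))).congr ?_
  filter_upwards [(hψ_L2 k).coeFn_toLp, (hψ_L2 l).coeFn_toLp] with y hk hl
  rw [hk, hl, RCLike.inner_apply, mul_comm]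

include hψ_orth in
theorem integral_conj_mul (k l : Fin n) :
    ∫ y, (starRingEnd ℂ) (ψ k y) * ψ l y ∂μ = if k = l then 1 else 0 := by
  rw [← orthonormal_iff_ite.1 hψ_orth k l, L2.inner_def]
  refine integral_congr_ae ?_
  filter_upwards [(hψ_L2 k).coeFn_toLp, (hψ_L2 l).coeFn_toLp] with y hk hl
  rw [hk, hl, RCLike.inner_apply, mul_comm]

include hψ_L2 in
theorem integrable_diagKernel : Integrable (diagKernel ψ) μ := by
  unfold diagKernel
  exact integrable_finsetSum _ fun k _ => (hψ_L2 k).integrable_norm_pow (by norm_num)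

include hψ_orth in
theorem integral_diagKernel : ∫ x, diagKernel ψ x ∂μ = n := by
  have h : ∀ k, ∫ x, ‖ψ k x‖ ^ 2 ∂μ = 1 := by
    intro k
    have h1 := integral_conj_mul hψ_L2 hψ_orth k k
    simp_rw [← Complex.normSq_eq_conj_mul_self, integral_complex_ofReal] at h1
    simp only [if_true, Complex.normSq_eq_norm_sq] at h1
    exact_mod_cast h1
  unfold diagKernel
  rw [integral_finsetSum _ fun k _ => (hψ_L2 k).integrable_norm_pow (by norm_num)]
  simp [h]

include hψ_orth in
-- Expanding |K(x, y)|² and integrating in y leaves only the diagonal terms, by orthonormality. This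
-- is the continuous counterpart of Pᵢᵢ = ∑ⱼ |Pᵢⱼ|².
theorem integral_norm_projKernel_sq (x : E) :
    ∫ y, ‖projKernel ψ x y‖ ^ 2 ∂μ = diagKernel ψ x := by
  have h1 : ∀ y, ((‖projKernel ψ x y‖ ^ 2 : ℝ) : ℂ) = ∑ k, ∑ l,
      ψ k x * (starRingEnd ℂ) (ψ l x) * ((starRingEnd ℂ) (ψ k y) * ψ l y) := by
    intro y
    rw [← Complex.normSq_eq_norm_sq, ← Complex.mul_conj, conj_projKernel, projKernel, projKernel,
      Finset.sum_mul_sum]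
    refine Finset.sum_congr rfl fun k _ => Finset.sum_congr rfl fun l _ => ?_
    ring
  have h2 : ((∫ y, ‖projKernel ψ x y‖ ^ 2 ∂μ : ℝ) : ℂ) = (diagKernel ψ x : ℂ) := by
    rw [← integral_complex_ofReal]
    simp_rw [h1]
    rw [integral_finsetSum _ fun k _ => integrable_finsetSum _ fun l _ =>
      (integrable_conj_mul hψ_L2 k l).const_mul _]
    rw [← projKernel_self, projKernel]
    refine Finset.sum_congr rfl fun k _ => ?_
    rw [integral_finsetSum _ fun l _ => (integrable_conj_mul hψ_L2 k l).const_mul _]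
    simp_rw [integral_const_mul, integral_conj_mul hψ_L2 hψ_orth]
    simp
  exact_mod_cast h2

include hψ_meas hψ_L2 in
/-- A bounded function times `|K(x, y)|²` is integrable. -/
theorem integrable_mul_norm_projKernel_sq [SFinite μ] {g : E × E → ℝ} (hg : Measurable g) {C : ℝ}
    (hC : ∀ p, |g p| ≤ C) :
    Integrable (fun p : E × E => g p * ‖projKernel ψ p.1 p.2‖ ^ 2) (μ.prod μ) := by
  have hK : Integrable (fun p : E × E => ‖projKernel ψ p.1 p.2‖ ^ 2) (μ.prod μ) := by
    refine ((integrable_diagKernel hψ_L2).mul_prod (integrable_diagKernel hψ_L2)).mono'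
      ((measurable_projKernel hψ_meas).norm.pow_const 2).aestronglyMeasurable
      (Filter.Eventually.of_forall fun p => ?_)
    rw [Real.norm_eq_abs, abs_of_nonneg (by positivity)]
    exact norm_projKernel_sq_le ψ p.1 p.2
  exact hK.bdd_mul hg.aestronglyMeasurable (Filter.Eventually.of_forall hC)

include hψ_meas hψ_orth in
/-- Two expressions for the variance of a linear statistic of a projection DPP. -/
theorem integral_sub_sq_mul_norm_projKernel_sq [SFinite μ] {h : E → ℝ} (hh : Measurable h) {C : ℝ}
    (hC : ∀ x, |h x| ≤ C) :
    1 / 2 * ∫ p : E × E, (h p.1 - h p.2) ^ 2 * ‖projKernel ψ p.1 p.2‖ ^ 2 ∂(μ.prod μ) =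
      (∫ x, h x ^ 2 * diagKernel ψ x ∂μ) -
        ∫ p : E × E, h p.1 * h p.2 * ‖projKernel ψ p.1 p.2‖ ^ 2 ∂(μ.prod μ) := by
  have hC2 : ∀ x y, |h x * h y| ≤ C * C := fun x y => by
    rw [abs_mul]
    exact mul_le_mul (hC x) (hC y) (abs_nonneg _) ((abs_nonneg _).trans (hC x))
  have i1 : Integrable (fun p : E × E => h p.1 ^ 2 * ‖projKernel ψ p.1 p.2‖ ^ 2) (μ.prod μ) :=
    integrable_mul_norm_projKernel_sq hψ_meas hψ_L2 (by fun_prop)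
      (fun p => by rw [sq]; exact hC2 _ _)
  have i2 : Integrable (fun p : E × E => h p.2 ^ 2 * ‖projKernel ψ p.1 p.2‖ ^ 2) (μ.prod μ) :=
    integrable_mul_norm_projKernel_sq hψ_meas hψ_L2 (by fun_prop)
      (fun p => by rw [sq]; exact hC2 _ _)
  have i3 : Integrable (fun p : E × E => h p.1 * h p.2 * ‖projKernel ψ p.1 p.2‖ ^ 2)
      (μ.prod μ) :=
    integrable_mul_norm_projKernel_sq hψ_meas hψ_L2 (by fun_prop) (fun p => hC2 _ _)
  have e1 : ∫ p : E × E, h p.1 ^ 2 * ‖projKernel ψ p.1 p.2‖ ^ 2 ∂(μ.prod μ) =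
      ∫ x, h x ^ 2 * diagKernel ψ x ∂μ := by
    rw [integral_prod _ i1]
    refine integral_congr_ae (Filter.Eventually.of_forall fun x => ?_)
    simp only
    rw [integral_const_mul, integral_norm_projKernel_sq hψ_L2 hψ_orth]
  have e2 : ∫ p : E × E, h p.2 ^ 2 * ‖projKernel ψ p.1 p.2‖ ^ 2 ∂(μ.prod μ) =
      ∫ x, h x ^ 2 * diagKernel ψ x ∂μ := by
    rw [← e1, ← integral_prod_swap]
    refine integral_congr_ae (Filter.Eventually.of_forall fun p => ?_)
    simp only [Prod.fst_swap, Prod.snd_swap]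
    rw [← conj_projKernel, RCLike.norm_conj]
  have e3 : ∀ p : E × E, (h p.1 - h p.2) ^ 2 * ‖projKernel ψ p.1 p.2‖ ^ 2 =
      h p.1 ^ 2 * ‖projKernel ψ p.1 p.2‖ ^ 2 + h p.2 ^ 2 * ‖projKernel ψ p.1 p.2‖ ^ 2 -
        2 * (h p.1 * h p.2 * ‖projKernel ψ p.1 p.2‖ ^ 2) := by
    intro p; ring
  simp_rw [e3]
  have i12 : Integrable (fun p : E × E => h p.1 ^ 2 * ‖projKernel ψ p.1 p.2‖ ^ 2 +
      h p.2 ^ 2 * ‖projKernel ψ p.1 p.2‖ ^ 2) (μ.prod μ) := i1.add i2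
  rw [integral_sub i12 (i3.const_mul 2), integral_add i1 i2, e1, e2, integral_const_mul]
  ring

end Kernel

/-! ### First and second moments from the correlation functions. -/

section PointProcess

variable {Ω E : Type*} [MeasurableSpace Ω] [TopologicalSpace E] [MeasurableSpace E]

/-- Linear statistics of nonnegative functions of a point process are measurable. -/
theorem IsPointProcess.measurable_tsum {S : Ω → Set E} (hS : IsPointProcess S) {h : E → ℝ≥0∞}
    (hh : Measurable h) : Measurable fun ω => ∑' y : S ω, h y := by
  refine Measurable.ennreal_induction (motive := fun h => Measurable fun ω => ∑' y : S ω, h y)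
    ?_ ?_ ?_ hh
  · intro c s hs
    have h1 : ∀ ω, ∑' y : S ω, s.indicator (fun _ => c) (y : E) =
        ((S ω ∩ s).encard : ℝ≥0∞) * c := by
      intro ω
      rw [← ENNReal.tsum_set_const, tsum_subtype (S ω), tsum_subtype (S ω ∩ s) (fun _ => c),
        Set.indicator_indicator]
    simp_rw [h1]
    exact (hS.measurable_count s hs).mul_const c
  · intro f g _ _ _ hf hg
    simp only [Pi.add_apply]
    simp_rw [ENNReal.tsum_add]
    exact hf.add hg
  · intro f hf hmono ih
    -- Monotone convergence for the counting measure on the configuration.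
    have h1 : ∀ ω, ∑' y : S ω, ⨆ k, f k (y : E) = ⨆ k, ∑' y : S ω, f k (y : E) := by
      intro ω
      let _ : MeasurableSpace (S ω) := ⊤
      have := lintegral_iSup (μ := (Measure.count : Measure (S ω)))
        (f := fun k (y : S ω) => f k (y : E)) (fun k => measurable_from_top)
        (fun a b hab y => hmono hab y)
      simpa [lintegral_count] using this
    simp_rw [h1]
    exact Measurable.iSup ih

/-- The square of a sum splits into an off-diagonal and a diagonal part. -/
theorem sq_tsum_eq {E : Type*} {S : Set E} (h : E → ℝ≥0∞) :
    (∑' y : S, h y) ^ 2 =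
      ∑' x : {x : Fin 2 → E // Function.Injective x ∧ ∀ i, x i ∈ S}, h (x.1 0) * h (x.1 1) +
        ∑' y : S, h y ^ 2 := by
  have h1 : (∑' y : S, h y) ^ 2 = ∑' p : S × S, h p.1 * h p.2 := by
    rw [sq, ENNReal.tsum_prod', ← ENNReal.tsum_mul_right]
    exact tsum_congr fun a => ENNReal.tsum_mul_left.symm
  let s : Set (S × S) := {p | p.1 ≠ p.2}
  have h2 := ENNReal.summable.tsum_add_tsum_compl (s := s) (f := fun p : S × S =>
    h p.1 * h p.2) ENNReal.summable
  rw [h1, ← h2]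
  congr 1
  · let e : s ≃ {x : Fin 2 → E // Function.Injective x ∧ ∀ i, x i ∈ S} :=
      { toFun := fun p => ⟨![p.1.1, p.1.2], by
          have hne : (p.1.1 : E) ≠ p.1.2 := fun h => p.2 (Subtype.ext h)
          constructor
          · intro a b hab
            fin_cases a <;> fin_cases b <;>
              first | rfl | exact absurd hab hne | exact absurd hab.symm hne
          · intro i; fin_cases i <;> simp⟩
        invFun := fun x => ⟨(⟨x.1 0, x.2.2 0⟩, ⟨x.1 1, x.2.2 1⟩), fun hx => by
          have := x.2.1 (Subtype.ext_iff.1 hx)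
          exact absurd this (by decide)⟩
        left_inv := fun p => by simp
        right_inv := fun x => by
          apply Subtype.ext
          ext i
          fin_cases i <;> rfl }
    rw [← e.tsum_eq]
    rfl
  · let e : S ≃ (sᶜ : Set (S × S)) :=
      { toFun := fun y => ⟨(y, y), by simp [s]⟩
        invFun := fun p => p.1.1
        left_inv := fun y => rfl
        right_inv := fun p => by
          have : p.1.1 = p.1.2 := not_not.1 p.2
          apply Subtype.ext
          exact Prod.ext rfl this }
    rw [← e.tsum_eq]
    exact tsum_congr fun y => (sq _).symm

variable {P : Measure Ω} {S : Ω → Set E} {n : ℕ} {ψ : Fin n → E → ℂ}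
  {μ : Measure E} [SigmaFinite μ]

omit [SigmaFinite μ] in
/-- The first moment formula. -/
theorem IsDPP.lintegral_tsum (hS : IsDPP P S (projKernel ψ) μ) {h : E → ℝ≥0∞}
    (hh : Measurable h) :
    ∫⁻ ω, ∑' y : S ω, h y ∂P = ∫⁻ x, h x * ENNReal.ofReal (diagKernel ψ x) ∂μ := by
  have h1 := hS.correlation 1 (fun x => h (x 0)) (by fun_prop)
  have h2 : ∀ ω, ∑' x : {x : Fin 1 → E // Function.Injective x ∧ ∀ i, x i ∈ S ω}, h (x.1 0) =
      ∑' y : S ω, h y := by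
    intro ω
    let e : {x : Fin 1 → E // Function.Injective x ∧ ∀ i, x i ∈ S ω} ≃ S ω :=
      { toFun := fun x => ⟨x.1 0, x.2.2 0⟩
        invFun := fun y => ⟨fun _ => y, fun a b _ => Subsingleton.elim a b, fun _ => y.2⟩
        left_inv := fun x => by
          apply Subtype.ext
          ext i
          rw [Subsingleton.elim i 0]
        right_inv := fun y => rfl }
    rw [← e.tsum_eq]
    rfl
  simp_rw [h2] at h1
  rw [h1]
  have he := measurePreserving_funUnique μ (Fin 1)
  rw [← he.lintegral_comp_emb (MeasurableEquiv.measurableEmbedding _)]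
  simp_rw [kernelDet_one]
  rfl

/-- The second moment formula. -/
theorem IsDPP.lintegral_sq_tsum (hS : IsDPP P S (projKernel ψ) μ) {h : E → ℝ≥0∞}
    (hh : Measurable h) :
    ∫⁻ ω, (∑' y : S ω, h y) ^ 2 ∂P =
      ∫⁻ p : E × E, h p.1 * h p.2 * ENNReal.ofReal (diagKernel ψ p.1 * diagKernel ψ p.2 -
        ‖projKernel ψ p.1 p.2‖ ^ 2) ∂(μ.prod μ) +
      ∫⁻ x, h x ^ 2 * ENNReal.ofReal (diagKernel ψ x) ∂μ := by
  have h1 := hS.correlation 2 (fun x => h (x 0) * h (x 1)) (by fun_prop)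
  simp_rw [sq_tsum_eq]
  rw [lintegral_add_right _ (hS.isPointProcess.measurable_tsum (hh.pow_const 2)), h1,
    hS.lintegral_tsum (hh.pow_const 2)]
  congr 1
  have he := measurePreserving_finTwoArrow μ
  rw [← he.lintegral_comp_emb (MeasurableEquiv.measurableEmbedding _)]
  simp_rw [kernelDet_two]
  rfl

end PointProcess

/-! ### Variance of linear statistics of the continuous DPP. -/

section ContinuousVariance

variable {Ω E : Type*} [MeasurableSpace Ω] [TopologicalSpace E] [MeasurableSpace E]
  {P : Measure Ω} [IsProbabilityMeasure P] {S : Ω → Set E} {n : ℕ} {ψ : Fin n → E → ℂ}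
  {μ : Measure E} [SigmaFinite μ] (hψ_meas : ∀ k, Measurable (ψ k))
  (hψ_L2 : ∀ k, MemLp (ψ k) 2 μ) (hψ_orth : Orthonormal ℂ fun k => (hψ_L2 k).toLp (ψ k))
  (hS : IsDPP P S (projKernel ψ) μ)

/-- Valid even for a divergent sum: both sides then take the default value 0. -/
theorem linStat_eq_toReal_tsum {E : Type*} {h : E → ℝ} (h0 : ∀ x, 0 ≤ h x) (T : Set E) :
    linStat h T = (∑' y : T, ENNReal.ofReal (h y)).toReal := by
  rw [linStat, ENNReal.tsum_toReal_eq fun _ => ENNReal.ofReal_ne_top]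
  exact tsum_congr fun y => (ENNReal.toReal_ofReal (h0 y)).symm

include hψ_meas hψ_orth hS in
/-- Square integrability and variance of a linear statistic of a nonnegative function. -/
theorem IsDPP.variance_linStat_of_nonneg {h : E → ℝ} (hh : Measurable h) (h0 : ∀ x, 0 ≤ h x)
    {C : ℝ} (hC : ∀ x, h x ≤ C) :
    (∀ᵐ ω ∂P, ∑' y : S ω, ENNReal.ofReal (h y) ≠ ∞) ∧ MemLp (fun ω => linStat h (S ω)) 2 P ∧
    ∫ ω, linStat h (S ω) ∂P = ∫ x, h x * diagKernel ψ x ∂μ ∧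
    variance (fun ω => linStat h (S ω)) P =
      1 / 2 * ∫ p : E × E, (h p.1 - h p.2) ^ 2 * ‖projKernel ψ p.1 p.2‖ ^ 2 ∂(μ.prod μ) := by
  have hCa : ∀ x, |h x| ≤ C := fun x => by rw [abs_of_nonneg (h0 x)]; exact hC x
  have hC2 : ∀ x y, |h x * h y| ≤ C * C := fun x y => by
    rw [abs_mul]
    exact mul_le_mul (hCa x) (hCa y) (abs_nonneg _) ((abs_nonneg _).trans (hCa x))
  have hd := integrable_diagKernel hψ_L2
  have hdm := measurable_diagKernel hψ_meas
  have hd0 := diagKernel_nonneg ψ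
  set Λ : Ω → ℝ≥0∞ := fun ω => ∑' y : S ω, ENNReal.ofReal (h y) with hΛ
  have hΛm : Measurable Λ := hS.isPointProcess.measurable_tsum hh.ennreal_ofReal
  -- first moment
  have i1 : Integrable (fun x => h x * diagKernel ψ x) μ :=
    hd.bdd_mul hh.aestronglyMeasurable (Filter.Eventually.of_forall hCa)
  have e1 : ∫⁻ ω, Λ ω ∂P = ENNReal.ofReal (∫ x, h x * diagKernel ψ x ∂μ) := by
    rw [hS.lintegral_tsum hh.ennreal_ofReal, ofReal_integral_eq_lintegral_ofReal i1
      (Filter.Eventually.of_forall fun x => mul_nonneg (h0 x) (hd0 x))]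
    exact lintegral_congr fun x => (ENNReal.ofReal_mul (h0 x)).symm
  -- second moment
  have i2 : Integrable (fun x => h x ^ 2 * diagKernel ψ x) μ :=
    hd.bdd_mul (hh.pow_const 2).aestronglyMeasurable
      (Filter.Eventually.of_forall fun x => by rw [sq]; exact hC2 x x)
  have i3 : Integrable (fun p : E × E => (h p.1 * diagKernel ψ p.1) * (h p.2 * diagKernel ψ p.2))
      (μ.prod μ) := i1.mul_prod i1
  have i4 : Integrable (fun p : E × E => h p.1 * h p.2 * ‖projKernel ψ p.1 p.2‖ ^ 2)
      (μ.prod μ) :=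
    integrable_mul_norm_projKernel_sq hψ_meas hψ_L2 (by fun_prop) (fun p => hC2 _ _)
  have i5 : Integrable (fun p : E × E => h p.1 * h p.2 * (diagKernel ψ p.1 * diagKernel ψ p.2 -
      ‖projKernel ψ p.1 p.2‖ ^ 2)) (μ.prod μ) := by
    refine (i3.sub i4).congr (Filter.Eventually.of_forall fun p => ?_)
    simp only [Pi.sub_apply]
    ring
  have e5 : ∫ p : E × E, h p.1 * h p.2 * (diagKernel ψ p.1 * diagKernel ψ p.2 -
      ‖projKernel ψ p.1 p.2‖ ^ 2) ∂(μ.prod μ) = (∫ x, h x * diagKernel ψ x ∂μ) ^ 2 -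
        ∫ p : E × E, h p.1 * h p.2 * ‖projKernel ψ p.1 p.2‖ ^ 2 ∂(μ.prod μ) := by
    rw [sq, ← integral_prod_mul, ← integral_sub i3 i4]
    refine integral_congr_ae (Filter.Eventually.of_forall fun p => ?_)
    simp only
    ring
  -- Nonnegativity lets this Bochner integral be read as the lower integral of the second moment
  -- formula.
  have p5 : ∀ p : E × E, 0 ≤ h p.1 * h p.2 * (diagKernel ψ p.1 * diagKernel ψ p.2 -
      ‖projKernel ψ p.1 p.2‖ ^ 2) := fun p =>
    mul_nonneg (mul_nonneg (h0 _) (h0 _)) (sub_nonneg.2 (norm_projKernel_sq_le ψ _ _))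
  have e2 : ∫⁻ ω, Λ ω ^ 2 ∂P = ENNReal.ofReal ((∫ x, h x * diagKernel ψ x ∂μ) ^ 2 -
        (∫ p : E × E, h p.1 * h p.2 * ‖projKernel ψ p.1 p.2‖ ^ 2 ∂(μ.prod μ)) +
        ∫ x, h x ^ 2 * diagKernel ψ x ∂μ) := by
    rw [hS.lintegral_sq_tsum hh.ennreal_ofReal, ← e5, ENNReal.ofReal_add (integral_nonneg p5)
      (integral_nonneg fun x => mul_nonneg (sq_nonneg _) (hd0 x)),
      ofReal_integral_eq_lintegral_ofReal i5 (Filter.Eventually.of_forall p5),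
      ofReal_integral_eq_lintegral_ofReal i2
        (Filter.Eventually.of_forall fun x => mul_nonneg (sq_nonneg _) (hd0 x))]
    congr 1
    · refine lintegral_congr fun p => ?_
      rw [ENNReal.ofReal_mul (mul_nonneg (h0 _) (h0 _)), ENNReal.ofReal_mul (h0 _)]
    · refine lintegral_congr fun x => ?_
      rw [ENNReal.ofReal_mul (sq_nonneg _), ENNReal.ofReal_pow (h0 x)]
  have hfin : ∀ᵐ ω ∂P, Λ ω ≠ ∞ := by
    filter_upwards [ae_lt_top hΛm (by rw [e1]; exact ENNReal.ofReal_ne_top)] with ω hω using hω.ne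
  have hlin : (fun ω => linStat h (S ω)) = fun ω => (Λ ω).toReal := by
    funext ω
    exact linStat_eq_toReal_tsum h0 _
  have hsq : ∫⁻ ω, ‖(Λ ω).toReal‖ₑ ^ 2 ∂P = ∫⁻ ω, Λ ω ^ 2 ∂P := by
    refine lintegral_congr_ae ?_
    filter_upwards [hfin] with ω hω
    rw [Real.enorm_of_nonneg ENNReal.toReal_nonneg, ENNReal.ofReal_toReal hω]
  have hmem : MemLp (fun ω => (Λ ω).toReal) 2 P := by
    refine ⟨hΛm.ennreal_toReal.aestronglyMeasurable, ?_⟩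
    rw [eLpNorm_lt_top_iff_lintegral_rpow_enorm_lt_top (by norm_num) (by norm_num)]
    simp only [ENNReal.toReal_ofNat, ENNReal.rpow_ofNat]
    rw [hsq, e2]
    exact ENNReal.ofReal_lt_top
  have hI1 : ∫ ω, (Λ ω).toReal ∂P = ∫ x, h x * diagKernel ψ x ∂μ := by
    rw [integral_toReal hΛm.aemeasurable (hfin.mono fun ω hω => hω.lt_top), e1,
      ENNReal.toReal_ofReal (integral_nonneg fun x => mul_nonneg (h0 x) (hd0 x))]
  have hI2 : ∫ ω, (Λ ω).toReal ^ 2 ∂P = (∫ x, h x * diagKernel ψ x ∂μ) ^ 2 -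
        (∫ p : E × E, h p.1 * h p.2 * ‖projKernel ψ p.1 p.2‖ ^ 2 ∂(μ.prod μ)) +
        ∫ x, h x ^ 2 * diagKernel ψ x ∂μ := by
    have h1 : ∀ ω, (Λ ω).toReal ^ 2 = (Λ ω ^ 2).toReal := fun ω => (ENNReal.toReal_pow _ _).symm
    simp_rw [h1]
    rw [integral_toReal (hΛm.pow_const 2).aemeasurable
      (hfin.mono fun ω hω => (ENNReal.pow_ne_top hω).lt_top), e2, ENNReal.toReal_ofReal]
    rw [← e5]
    exact add_nonneg (integral_nonneg p5)
      (integral_nonneg fun x => mul_nonneg (sq_nonneg _) (hd0 x))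
  rw [hlin]
  refine ⟨hfin, hmem, hI1, ?_⟩
  rw [variance_eq_sub hmem, integral_sub_sq_mul_norm_projKernel_sq hψ_meas hψ_L2 hψ_orth hh hCa]
  have : ∫ ω, ((fun ω => (Λ ω).toReal) ^ 2) ω ∂P = ∫ ω, (Λ ω).toReal ^ 2 ∂P := rfl
  rw [this, hI2, hI1]
  ring

include hψ_meas hψ_orth hS in
/-- A projection DPP of rank `n` has almost surely `n` points. -/
theorem IsDPP.ae_encard_eq : ∀ᵐ ω ∂P, (S ω).Finite ∧ (S ω).ncard = n := by
  obtain ⟨hfin, hmem, hI, hvar⟩ := hS.variance_linStat_of_nonneg hψ_meas hψ_L2 hψ_orth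
    (h := fun _ => 1) measurable_const (fun _ => zero_le_one) (C := 1) (fun _ => le_rfl)
  -- For a constant function the squared difference vanishes, so the number of points is almost
  -- surely equal to its mean n.
  have hv0 : variance (fun ω => linStat (fun _ => 1) (S ω)) P = 0 := by
    rw [hvar]; simp
  have hae := ae_eq_integral_of_variance_eq_zero hmem hv0
  rw [hI] at hae
  simp_rw [one_mul, integral_diagKernel hψ_L2 hψ_orth] at hae
  filter_upwards [hfin, hae] with ω h1 h2
  rw [ENNReal.ofReal_one, ENNReal.tsum_set_one] at h1
  have hf : (S ω).Finite := by
    rw [← Set.encard_ne_top_iff]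
    intro h
    exact h1 (by rw [h]; rfl)
  refine ⟨hf, ?_⟩
  rw [linStat_eq_toReal_tsum (fun _ => zero_le_one), ENNReal.ofReal_one, ENNReal.tsum_set_one,
    ← hf.cast_ncard_eq] at h2
  simpa using h2

include hψ_meas hψ_orth hS in
/-- The variance of a bounded linear statistic of a projection DPP. -/
theorem IsDPP.variance_linStat {f : E → ℝ} (hf : Measurable f) {C : ℝ} (hC : ∀ x, |f x| ≤ C) :
    variance (fun ω => linStat f (S ω)) P =
      1 / 2 * ∫ p : E × E, (f p.1 - f p.2) ^ 2 * ‖projKernel ψ p.1 p.2‖ ^ 2 ∂(μ.prod μ) := by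
  -- The shift f + C is nonnegative. As there are almost surely n points, it changes the statistic
  -- by the constant C n and leaves the variance alone.
  obtain ⟨-, hmem, -, hvar⟩ := hS.variance_linStat_of_nonneg hψ_meas hψ_L2 hψ_orth
    (h := fun x => f x + C) (by fun_prop) (fun x => by linarith [(abs_le.1 (hC x)).1])
    (C := 2 * C) (fun x => by linarith [(abs_le.1 (hC x)).2])
  simp only [add_sub_add_right_eq_sub] at hvar
  rw [← hvar, ← variance_sub_const hmem.aestronglyMeasurable (C * n)]
  refine variance_congr ?_
  filter_upwards [hS.ae_encard_eq hψ_meas hψ_L2 hψ_orth] with ω ⟨hfin, hcard⟩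
  have := hfin.fintype
  have hn : Fintype.card (S ω) = n := by rw [← hcard, Set.ncard_eq_toFinset_card', Set.toFinset_card]
  simp only [linStat, tsum_fintype, Finset.sum_add_distrib, Finset.sum_const, Finset.card_univ, hn]
  simp
  ring

end ContinuousVariance

/-! ### Empirical functionals for unit density, and their bounded differences. -/

section Empirical

variable {E : Type*} {n N : ℕ} (φ : Fin n → E → ℂ) (f : E → ℝ) (x : Fin N → E)

/-- The density is taken to be 1 because ρ^{-1/2} will be absorbed into the functions φ. -/
theorem lMatrix_one_apply (i j : Fin N) :
    lMatrix φ (fun _ => 1) x i j = (N : ℂ)⁻¹ * projKernel φ (x i) (x j) := by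
  have hN : (((√N)⁻¹ : ℝ) : ℂ) * (((√N)⁻¹ : ℝ) : ℂ) = (N : ℂ)⁻¹ := by
    rw [← Complex.ofReal_mul, ← mul_inv, Real.mul_self_sqrt (Nat.cast_nonneg N)]
    simp
  rw [lMatrix_eq, Matrix.mul_apply, projKernel, Finset.mul_sum]
  refine Finset.sum_congr rfl fun k _ => ?_
  rw [← hN]
  simp [whitenedMatrix]
  ring

theorem norm_lMatrix_one_sq (i j : Fin N) :
    ‖lMatrix φ (fun _ => 1) x i j‖ ^ 2 = ((N : ℝ) ^ 2)⁻¹ * ‖projKernel φ (x i) (x j)‖ ^ 2 := by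
  rw [lMatrix_one_apply, norm_mul, mul_pow, norm_inv, Complex.norm_natCast, inv_pow]

theorem empiricalVar_one : empiricalVar φ (fun _ => 1) f x =
    ((N : ℝ) ^ 2)⁻¹ * (1 / 2) * ∑ i, ∑ j,
      (f (x i) - f (x j)) ^ 2 * ‖projKernel φ (x i) (x j)‖ ^ 2 := by
  rw [empiricalVar]
  simp_rw [norm_lMatrix_one_sq, Finset.mul_sum]
  exact Finset.sum_congr rfl fun i _ => Finset.sum_congr rfl fun j _ => by ring

/-- With S = Φ*Φ, this is tr S² − 2 tr S + n, where tr S² = tr L². Written as sums over the sample,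
its expectation can be computed. -/
theorem gramError_one : gramError φ (fun _ => 1) x =
    ((N : ℝ) ^ 2)⁻¹ * (∑ i, ∑ j, ‖projKernel φ (x i) (x j)‖ ^ 2) -
      2 * (N : ℝ)⁻¹ * ∑ i, diagKernel φ (x i) + n := by
  set Φ := whitenedMatrix φ (fun _ => 1) x with hΦ
  have hL : lMatrix φ (fun _ => 1) x = Φ * Φᴴ := lMatrix_eq _ _ _
  have hLH : (Φ * Φᴴ).IsHermitian := Matrix.isHermitian_mul_conjTranspose_self Φ
  have hSH : (Φᴴ * Φ).IsHermitian := Matrix.isHermitian_conjTranspose_mul_self Φ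
  have h1 := sum_norm_sq_eq_trace _ hLH
  have h2 := sum_norm_sq_eq_trace _ (hSH.sub Matrix.isHermitian_one)
  have h3 : (Φ * Φᴴ * (Φ * Φᴴ)).trace = (Φᴴ * Φ * (Φᴴ * Φ)).trace := by
    rw [Matrix.mul_assoc, Matrix.trace_mul_comm]
    simp only [Matrix.mul_assoc]
  have h4 : (Φᴴ * Φ).trace = (((N : ℝ)⁻¹ * ∑ i, diagKernel φ (x i) : ℝ) : ℂ) := by
    rw [Matrix.trace_mul_comm, ← hL, Matrix.trace]
    simp only [Matrix.diag, lMatrix_one_apply, projKernel_self]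
    push_cast
    rw [Finset.mul_sum]
  have h5 : (gramError φ (fun _ => 1) x : ℂ) =
      ((∑ i, ∑ j, ‖lMatrix φ (fun _ => 1) x i j‖ ^ 2 : ℝ) : ℂ) -
        2 * (((N : ℝ)⁻¹ * ∑ i, diagKernel φ (x i) : ℝ) : ℂ) + n := by
    rw [gramError, ← hΦ, h2, hL, h1, h3, ← h4, Matrix.sub_mul, Matrix.mul_sub, Matrix.mul_sub]
    simp only [Matrix.trace_sub, Matrix.one_mul, Matrix.mul_one, Matrix.trace_one, Fintype.card_fin]
    ring
  have h6 : gramError φ (fun _ => 1) x = (∑ i, ∑ j, ‖lMatrix φ (fun _ => 1) x i j‖ ^ 2) -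
        2 * ((N : ℝ)⁻¹ * ∑ i, diagKernel φ (x i)) + n := by exact_mod_cast h5
  rw [h6]
  simp_rw [norm_lMatrix_one_sq, ← Finset.mul_sum]
  ring

/-- The rank-one matrix `conj φ(y) φ(y)ᵀ` as a Euclidean vector. -/
noncomputable def featureVec (y : E) : EuclideanSpace ℂ (Fin n × Fin n) :=
  WithLp.toLp 2 fun p => (starRingEnd ℂ) (φ p.1 y) * φ p.2 y

theorem inner_featureVec (a b : E) :
    inner ℂ (featureVec φ a) (featureVec φ b) = ((‖projKernel φ a b‖ ^ 2 : ℝ) : ℂ) := by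
  rw [PiLp.inner_apply, Fintype.sum_prod_type, ← Complex.normSq_eq_norm_sq, ← Complex.mul_conj,
    conj_projKernel, projKernel, projKernel, Finset.sum_mul_sum]
  refine Finset.sum_congr rfl fun k _ => Finset.sum_congr rfl fun l _ => ?_
  simp [featureVec]
  ring

/-- Inner products of feature vectors are nonnegative, so the squared distance is at most the sum of
the squared norms: √2 K instead of 2K. -/
theorem norm_featureVec_sub_le {K : ℝ} (hK : ∀ y, diagKernel φ y ≤ K) (a b : E) :
    ‖featureVec φ a - featureVec φ b‖ ≤ √2 * K := by
  have hK0 : 0 ≤ K := (diagKernel_nonneg φ a).trans (hK a)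
  have hn : ∀ a, ‖featureVec φ a‖ ^ 2 ≤ K ^ 2 := by
    intro a
    have h2 : ‖featureVec φ a‖ ^ 2 = ‖projKernel φ a a‖ ^ 2 := by
      rw [@norm_sq_eq_re_inner ℂ, inner_featureVec]
      exact Complex.ofReal_re _
    rw [h2, projKernel_self, Complex.norm_real, Real.norm_eq_abs,
      abs_of_nonneg (diagKernel_nonneg φ a)]
    exact pow_le_pow_left₀ (diagKernel_nonneg φ a) (hK a) 2
  have h1 : ‖featureVec φ a - featureVec φ b‖ ^ 2 ≤ (√2 * K) ^ 2 := by
    rw [@norm_sub_sq ℂ, inner_featureVec, mul_pow, Real.sq_sqrt (by norm_num)]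
    have h2 : RCLike.re ((‖projKernel φ a b‖ ^ 2 : ℝ) : ℂ) = ‖projKernel φ a b‖ ^ 2 :=
      Complex.ofReal_re _
    rw [h2]
    have := sq_nonneg ‖projKernel φ a b‖
    linarith [hn a, hn b]
  exact le_of_sq_le_sq h1 (by positivity)

/-- The square root is a norm of an empirical mean minus a fixed vector, hence Lipschitz in each
sample point. This is why concentration is proved for the root. -/
theorem sqrt_gramError_one : √(gramError φ (fun _ => 1) x) =
    ‖(N : ℂ)⁻¹ • ∑ i, featureVec φ (x i) -
      WithLp.toLp 2 fun p : Fin n × Fin n => if p.1 = p.2 then (1 : ℂ) else 0‖ := by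
  have hN : (((√N)⁻¹ : ℝ) : ℂ) * (((√N)⁻¹ : ℝ) : ℂ) = (N : ℂ)⁻¹ := by
    rw [← Complex.ofReal_mul, ← mul_inv, Real.mul_self_sqrt (Nat.cast_nonneg N)]
    simp
  rw [EuclideanSpace.norm_eq, gramError, Fintype.sum_prod_type]
  congr 1
  refine Finset.sum_congr rfl fun k _ => Finset.sum_congr rfl fun l _ => ?_
  congr 2
  rw [Matrix.sub_apply, Matrix.one_apply, Matrix.mul_apply]
  simp only [PiLp.sub_apply, PiLp.smul_apply, WithLp.ofLp_sum, Finset.sum_apply, smul_eq_mul,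
    Finset.mul_sum]
  congr 1
  refine Finset.sum_congr rfl fun i _ => ?_
  rw [← hN]
  simp [featureVec, whitenedMatrix]
  ring

theorem abs_sqrt_gramError_sub_le {K : ℝ} (hK : ∀ y, diagKernel φ y ≤ K) (i : Fin N) (y : E) :
    |√(gramError φ (fun _ => 1) x) - √(gramError φ (fun _ => 1) (Function.update x i y))| ≤
      √2 * K / N := by
  rw [sqrt_gramError_one, sqrt_gramError_one]
  refine (abs_norm_sub_norm_le _ _).trans ?_
  rw [sub_sub_sub_cancel_right, ← smul_sub, ← Finset.sum_sub_distrib, Finset.sum_eq_single i]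
  · rw [Function.update_self, norm_smul, norm_inv, Complex.norm_natCast, inv_mul_eq_div]
    gcongr
    exact norm_featureVec_sub_le φ hK _ _
  · intro j _ hj
    rw [Function.update_of_ne hj, sub_self]
  · simp

/-- Resampling one point affects one row and one column, at most 2N entries, each by at most B =
4C²K²; the prefactor 1/(2N²) gives B/N. -/
theorem abs_empiricalVar_sub_le {K C : ℝ} (hK : ∀ y, diagKernel φ y ≤ K) (hC : ∀ y, |f y| ≤ C)
    (i : Fin N) (y : E) :
    |empiricalVar φ (fun _ => 1) f x - empiricalVar φ (fun _ => 1) f (Function.update x i y)| ≤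
      4 * C ^ 2 * K ^ 2 / N := by
  set x' := Function.update x i y
  have hN : (0 : ℝ) < N := by exact_mod_cast (Fin.pos i)
  have hK0 : 0 ≤ K := (diagKernel_nonneg φ y).trans (hK y)
  set q : E → E → ℝ := fun a b => (f a - f b) ^ 2 * ‖projKernel φ a b‖ ^ 2 with hq
  have hq0 : ∀ a b, 0 ≤ q a b := fun a b => by positivity
  have hqB : ∀ a b, q a b ≤ 4 * C ^ 2 * K ^ 2 := by
    intro a b
    have h1 : (f a - f b) ^ 2 ≤ 4 * C ^ 2 := by
      have hi := abs_le.1 (hC a)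
      have hj := abs_le.1 (hC b)
      have : |f a - f b| ≤ 2 * C := by rw [abs_le]; constructor <;> linarith
      nlinarith [sq_abs (f a - f b), abs_nonneg (f a - f b)]
    have h2 : ‖projKernel φ a b‖ ^ 2 ≤ K ^ 2 := by
      refine (norm_projKernel_sq_le φ a b).trans ?_
      rw [sq]
      exact mul_le_mul (hK a) (hK b) (diagKernel_nonneg φ b) hK0
    exact mul_le_mul h1 h2 (by positivity) (by positivity)
  set B := 4 * C ^ 2 * K ^ 2
  have hd : ∀ a b, |q (x a) (x b) - q (x' a) (x' b)| ≤
      (if a = i then B else 0) + (if b = i then B else 0) := by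
    intro a b
    have h1 : |q (x a) (x b) - q (x' a) (x' b)| ≤ B :=
      abs_sub_le_of_nonneg_of_le (hq0 _ _) (hqB _ _) (hq0 _ _) (hqB _ _)
    have hB : 0 ≤ B := (hq0 y y).trans (hqB y y)
    by_cases ha : a = i
    · simp only [ha, if_true] at h1 ⊢
      split_ifs <;> linarith
    · by_cases hb : b = i
      · simp only [hb, if_true, ha, if_false, zero_add] at h1 ⊢
        exact h1
      · simp [x', ha, hb]
  rw [empiricalVar_one, empiricalVar_one, ← mul_sub, abs_mul, ← Finset.sum_sub_distrib]
  have h2 : |∑ a, ((∑ b, q (x a) (x b)) - ∑ b, q (x' a) (x' b))| ≤ 2 * N * B := by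
    calc |∑ a, ((∑ b, q (x a) (x b)) - ∑ b, q (x' a) (x' b))|
        ≤ ∑ a, ∑ b, |q (x a) (x b) - q (x' a) (x' b)| := by
          refine (Finset.abs_sum_le_sum_abs _ _).trans (Finset.sum_le_sum fun a _ => ?_)
          rw [← Finset.sum_sub_distrib]
          exact Finset.abs_sum_le_sum_abs _ _
      _ ≤ ∑ a : Fin N, ∑ b : Fin N, ((if a = i then B else 0) + (if b = i then B else 0)) :=
          Finset.sum_le_sum fun a _ => Finset.sum_le_sum fun b _ => hd a b
      _ = 2 * N * B := by
          simp [Finset.sum_add_distrib]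
          ring
  rw [abs_of_nonneg (by positivity : (0 : ℝ) ≤ ((N : ℝ) ^ 2)⁻¹ * (1 / 2))]
  calc ((N : ℝ) ^ 2)⁻¹ * (1 / 2) * |∑ a, ((∑ b, q (x a) (x b)) - ∑ b, q (x' a) (x' b))|
      ≤ ((N : ℝ) ^ 2)⁻¹ * (1 / 2) * (2 * N * B) := by gcongr
    _ = B / N := by field_simp

end Empirical

/-! ### Means and concentration of the empirical functionals. -/

section Concentration

variable {E : Type*} [MeasurableSpace E] {ν : Measure E} [IsProbabilityMeasure ν] {n N : ℕ}

/-- A pair of distinct coordinates of an i.i.d. sample has the product law. -/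
theorem integral_pi_pair {i j : Fin N} (hij : i ≠ j) {g : E × E → ℝ} (hg : Measurable g) :
    ∫ x : Fin N → E, g (x i, x j) ∂(Measure.pi fun _ => ν) = ∫ p, g p ∂(ν.prod ν) := by
  have hind : iIndepFun (fun (i : Fin N) (x : Fin N → E) => x i) (Measure.pi fun _ => ν) :=
    iIndepFun_pi (X := fun _ : Fin N => (id : E → E)) (fun _ => aemeasurable_id)
  have h1 := (hind.indepFun hij).map_prod_eq_prod_map_map (measurable_pi_apply i).aemeasurable
    (measurable_pi_apply j).aemeasurable
  rw [(measurePreserving_eval (fun _ : Fin N => ν) i).map_eq,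
    (measurePreserving_eval (fun _ : Fin N => ν) j).map_eq] at h1
  rw [← h1, integral_map ((measurable_pi_apply i).prodMk (measurable_pi_apply j)).aemeasurable
    hg.aestronglyMeasurable]

theorem integral_pi_single (i : Fin N) {g : E → ℝ} (hg : Measurable g) :
    ∫ x : Fin N → E, g (x i) ∂(Measure.pi fun _ => ν) = ∫ y, g y ∂ν := by
  have h := measurePreserving_eval (fun _ : Fin N => ν) i
  rw [← h.map_eq, integral_map h.measurable.aemeasurable hg.aestronglyMeasurable, h.map_eq]

/-- Expectation of a double sum over an i.i.d. sample. -/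
theorem integral_pi_sum_sum {g : E × E → ℝ} (hg : Measurable g) {C : ℝ} (hC : ∀ p, |g p| ≤ C) :
    ∫ x : Fin N → E, ∑ i, ∑ j, g (x i, x j) ∂(Measure.pi fun _ => ν) =
      N * (∫ y, g (y, y) ∂ν) + N * (N - 1) * ∫ p, g p ∂(ν.prod ν) := by
  have hm : ∀ i j : Fin N, Measurable fun x : Fin N → E => g (x i, x j) := fun i j =>
    hg.comp ((measurable_pi_apply i).prodMk (measurable_pi_apply j))
  have hint : ∀ i j : Fin N, Integrable (fun x : Fin N → E => g (x i, x j))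
      (Measure.pi fun _ => ν) := fun i j => integrable_of_abs_le _ (hm i j) fun _ => hC _
  rw [integral_finsetSum _ fun i _ => integrable_finsetSum _ fun j _ => hint i j]
  have h1 : ∀ i j : Fin N, ∫ x : Fin N → E, g (x i, x j) ∂(Measure.pi fun _ => ν) =
      (∫ p, g p ∂(ν.prod ν)) +
        if i = j then (∫ y, g (y, y) ∂ν) - ∫ p, g p ∂(ν.prod ν) else 0 := by
    intro i j
    split_ifs with h
    · subst h
      rw [integral_pi_single (g := fun y => g (y, y)) i (by fun_prop)]
      ring
    · rw [integral_pi_pair h hg, add_zero]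
  have h2 : ∀ i : Fin N, ∫ x : Fin N → E, ∑ j, g (x i, x j) ∂(Measure.pi fun _ => ν) =
      N * (∫ p, g p ∂(ν.prod ν)) + ((∫ y, g (y, y) ∂ν) - ∫ p, g p ∂(ν.prod ν)) := by
    intro i
    rw [integral_finsetSum _ fun j _ => hint i j]
    simp_rw [h1, Finset.sum_add_distrib]
    simp
  simp_rw [h2]
  simp
  ring

variable {φ : Fin n → E → ℂ} (hφ_meas : ∀ k, Measurable (φ k)) {K : ℝ}
  (hK : ∀ y, diagKernel φ y ≤ K)

include hφ_meas in
theorem measurable_projKernel_pi (i j : Fin N) :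
    Measurable fun x : Fin N → E => projKernel φ (x i) (x j) :=
  (measurable_projKernel hφ_meas).comp (g := fun p : E × E => projKernel φ p.1 p.2)
    (f := fun x : Fin N → E => (x i, x j))
    ((measurable_pi_apply i).prodMk (measurable_pi_apply j))

include hφ_meas in
theorem measurable_empiricalVar {f : E → ℝ} (hf : Measurable f) :
    Measurable (empiricalVar (N := N) φ (fun _ => 1) f) := by
  have h2 := measurable_projKernel_pi (N := N) hφ_meas
  rw [funext fun x => empiricalVar_one (N := N) φ f x]
  fun_prop

include hφ_meas in
theorem measurable_gramError : Measurable (gramError (N := N) φ (fun _ => 1)) := by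
  have h2 := measurable_projKernel_pi (N := N) hφ_meas
  have h3 := measurable_diagKernel hφ_meas
  rw [funext fun x => gramError_one (N := N) φ x]
  fun_prop

omit [MeasurableSpace E] in
include hK in
theorem norm_projKernel_sq_le_sq (a b : E) : ‖projKernel φ a b‖ ^ 2 ≤ K ^ 2 := by
  refine (norm_projKernel_sq_le φ a b).trans ?_
  rw [sq]
  exact mul_le_mul (hK a) (hK b) (diagKernel_nonneg φ b) ((diagKernel_nonneg φ a).trans (hK a))

omit [MeasurableSpace E] in
include hK in
theorem sub_sq_mul_norm_projKernel_sq_le {f : E → ℝ} {C : ℝ} (hC : ∀ y, |f y| ≤ C) (a b : E) :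
    (f a - f b) ^ 2 * ‖projKernel φ a b‖ ^ 2 ≤ 4 * C ^ 2 * K ^ 2 := by
  have h1 : (f a - f b) ^ 2 ≤ 4 * C ^ 2 := by
    have hi := abs_le.1 (hC a)
    have hj := abs_le.1 (hC b)
    have : |f a - f b| ≤ 2 * C := by rw [abs_le]; constructor <;> linarith
    nlinarith [sq_abs (f a - f b), abs_nonneg (f a - f b)]
  exact mul_le_mul h1 (norm_projKernel_sq_le_sq hK a b) (by positivity) (by positivity)

include hφ_meas hK in
-- The diagonal terms vanish, so N(N − 1) pairs remain against the normalisation N².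
theorem integral_empiricalVar (hN : 1 ≤ N) {f : E → ℝ} (hf : Measurable f) {C : ℝ}
    (hC : ∀ y, |f y| ≤ C) :
    ∫ x : Fin N → E, empiricalVar φ (fun _ => 1) f x ∂(Measure.pi fun _ => ν) =
      ((N : ℝ) - 1) / N *
        (1 / 2 * ∫ p : E × E, (f p.1 - f p.2) ^ 2 * ‖projKernel φ p.1 p.2‖ ^ 2 ∂(ν.prod ν)) := by
  have h := measurable_projKernel hφ_meas
  simp_rw [empiricalVar_one]
  rw [integral_const_mul, integral_pi_sum_sum
    (g := fun p => (f p.1 - f p.2) ^ 2 * ‖projKernel φ p.1 p.2‖ ^ 2) (by fun_prop)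
    (C := 4 * C ^ 2 * K ^ 2) fun p => by
      rw [abs_of_nonneg (by positivity)]
      exact sub_sq_mul_norm_projKernel_sq_le hK hC _ _]
  have hN' : (N : ℝ) ≠ 0 := by positivity
  simp
  field_simp

omit [MeasurableSpace E] in
theorem empiricalVar_nonneg (f : E → ℝ) (x : Fin N → E) :
    0 ≤ empiricalVar φ (fun _ => 1) f x := by
  unfold empiricalVar
  positivity

omit [MeasurableSpace E] in
include hK in
theorem empiricalVar_le (hN : 1 ≤ N) {f : E → ℝ} {C : ℝ} (hC : ∀ y, |f y| ≤ C) (x : Fin N → E) :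
    empiricalVar φ (fun _ => 1) f x ≤ 2 * C ^ 2 * K ^ 2 := by
  have hN' : (0 : ℝ) < N := by exact_mod_cast hN
  rw [empiricalVar_one]
  calc ((N : ℝ) ^ 2)⁻¹ * (1 / 2) * ∑ i, ∑ j,
      (f (x i) - f (x j)) ^ 2 * ‖projKernel φ (x i) (x j)‖ ^ 2
      ≤ ((N : ℝ) ^ 2)⁻¹ * (1 / 2) * ∑ i : Fin N, ∑ j : Fin N, 4 * C ^ 2 * K ^ 2 := by
        refine mul_le_mul_of_nonneg_left ?_ (by positivity)
        exact Finset.sum_le_sum fun i _ => Finset.sum_le_sum fun j _ =>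
          sub_sq_mul_norm_projKernel_sq_le hK hC _ _
    _ = 2 * C ^ 2 * K ^ 2 := by
        simp
        field_simp
        norm_num

include hφ_meas hK in
/-- Concentration of the empirical variance functional around its mean. -/
theorem measureReal_empiricalVar_deviation_le (hN : 1 ≤ N) (hK0 : 0 < K) {f : E → ℝ}
    (hf : Measurable f) {C : ℝ} (hC : ∀ y, |f y| ≤ C) {δ : ℝ} (hδ : δ ∈ Set.Ioo (0 : ℝ) 1) :
    (Measure.pi fun _ : Fin N => ν).real {x | 2 * C ^ 2 * K ^ 2 * √(2 * Real.log (2 / δ) / N) <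
      |empiricalVar φ (fun _ => 1) f x -
        ∫ z : Fin N → E, empiricalVar φ (fun _ => 1) f z ∂(Measure.pi fun _ => ν)|} ≤ δ := by
  have hN' : (0 : ℝ) < N := by exact_mod_cast hN
  have hE : Nonempty E := ν.nonempty_of_neZero
  have hC0 : 0 ≤ C := (abs_nonneg _).trans (hC hE.some)
  have hlog : 0 < Real.log (2 / δ) := Real.log_pos (by rw [lt_div_iff₀ hδ.1]; linarith [hδ.2])
  rcases hC0.eq_or_lt with hC0 | hC0
  -- For C = 0 the difference bound c is zero and McDiarmid's exponent degenerates; the functional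
  -- is then identically zero.
  · have hV : ∀ x : Fin N → E, empiricalVar φ (fun _ => 1) f x = 0 := fun x =>
      le_antisymm (by simpa [← hC0] using empiricalVar_le hK hN hC x) (empiricalVar_nonneg f x)
    simp [hV, ← hC0, hδ.1.le]
  set V : (Fin N → E) → ℝ := empiricalVar φ (fun _ => 1) f
  set M := ∫ z : Fin N → E, V z ∂(Measure.pi fun _ => ν) with hM
  set t := 2 * C ^ 2 * K ^ 2 * √(2 * Real.log (2 / δ) / N)
  set c := 4 * C ^ 2 * K ^ 2 / N
  have ht : 0 ≤ t := by positivity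
  have hVm : Measurable V := measurable_empiricalVar hφ_meas hf
  have hVb : ∀ x, |V x| ≤ 2 * C ^ 2 * K ^ 2 := fun x => by
    rw [abs_of_nonneg (empiricalVar_nonneg f x)]
    exact empiricalVar_le hK hN hC x
  have hc : ∀ x i y, |V x - V (Function.update x i y)| ≤ c := fun x i y =>
    abs_empiricalVar_sub_le φ f x hK hC i y
  have h1 := measureReal_ge_le_of_bounded_differences ν N V hVm hVb hc ht
  have h2 := measureReal_ge_le_of_bounded_differences ν N (fun x => -V x) hVm.neg
    (fun x => by rw [abs_neg]; exact hVb x)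
    (fun x i y => by rw [neg_sub_neg, abs_sub_comm]; exact hc x i y) ht
  -- The threshold t is chosen to give each of the two tails mass δ/2.
  have hexp : Real.exp (-(2 * t ^ 2 / (N * c ^ 2))) = δ / 2 := by
    have : 2 * t ^ 2 / (N * c ^ 2) = Real.log (2 / δ) := by
      simp only [t, c, mul_pow]
      rw [Real.sq_sqrt (by positivity)]
      field_simp
      norm_num
    rw [this, Real.exp_neg, Real.exp_log (by have := hδ.1; positivity), inv_div]
  rw [hexp] at h1 h2
  have hsub : {x | t < |V x - M|} ⊆ {x | t ≤ V x - M} ∪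
      {x | t ≤ -V x - ∫ y, -V y ∂(Measure.pi fun _ => ν)} := by
    intro x hx
    rw [integral_neg]
    have hx' : t < |V x - M| := hx
    rcases lt_abs.1 hx' with h | h
    · exact Or.inl h.le
    · refine Or.inr ?_
      change t ≤ -V x - -M
      linarith
  calc (Measure.pi fun _ : Fin N => ν).real {x | t < |V x - M|}
      ≤ _ := measureReal_mono hsub
    _ ≤ _ := measureReal_union_le _ _
    _ ≤ δ / 2 + δ / 2 := add_le_add h1 h2
    _ = δ := add_halves δ

variable (hφ_L2 : ∀ k, MemLp (φ k) 2 ν) (hφ_orth : Orthonormal ℂ fun k => (hφ_L2 k).toLp (φ k))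

include hφ_orth hK in
theorem natCast_le_of_diagKernel_le : (n : ℝ) ≤ K := by
  rw [← integral_diagKernel hφ_L2 hφ_orth]
  calc ∫ x, diagKernel φ x ∂ν ≤ ∫ _, K ∂ν :=
        integral_mono (integrable_diagKernel hφ_L2) (integrable_const _) hK
    _ = K := by simp

include hφ_meas hφ_orth hK in
-- The mean is exactly (∫ K(y, y)² dν − n)/N, the variance of an empirical mean, and ∫ K(y, y)² dν ≤
-- K n ≤ K².
theorem integral_gramError_le (hN : 1 ≤ N) :
    ∫ x : Fin N → E, gramError φ (fun _ => 1) x ∂(Measure.pi fun _ => ν) ≤ K ^ 2 / N := by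
  have hN' : (0 : ℝ) < N := by exact_mod_cast hN
  have hm := measurable_projKernel hφ_meas
  have hdm := measurable_diagKernel hφ_meas
  have hnK := natCast_le_of_diagKernel_le hK hφ_L2 hφ_orth
  have hdb : ∀ y, |diagKernel φ y| ≤ K := fun y => by
    rw [abs_of_nonneg (diagKernel_nonneg φ y)]; exact hK y
  have hb : ∀ p : E × E, |‖projKernel φ p.1 p.2‖ ^ 2| ≤ K ^ 2 := fun p => by
    rw [abs_of_nonneg (by positivity)]; exact norm_projKernel_sq_le_sq hK _ _
  have e1 := integral_pi_sum_sum (ν := ν) (N := N)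
    (g := fun p => ‖projKernel φ p.1 p.2‖ ^ 2) (by fun_prop) hb
  have e2 : ∫ p : E × E, ‖projKernel φ p.1 p.2‖ ^ 2 ∂(ν.prod ν) = n := by
    rw [integral_prod _ (integrable_of_abs_le _ (by fun_prop) hb)]
    simp only
    simp_rw [integral_norm_projKernel_sq hφ_L2 hφ_orth]
    exact integral_diagKernel hφ_L2 hφ_orth
  have e3 : ∫ y, ‖projKernel φ y y‖ ^ 2 ∂ν ≤ K * n := by
    rw [← integral_diagKernel hφ_L2 hφ_orth, ← integral_const_mul]
    refine integral_mono_of_nonneg (Filter.Eventually.of_forall fun y => by positivity)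
      ((integrable_diagKernel hφ_L2).const_mul K) (Filter.Eventually.of_forall fun y => ?_)
    simp only
    rw [projKernel_self, Complex.norm_real, Real.norm_eq_abs, sq_abs, sq]
    exact mul_le_mul_of_nonneg_right (hK y) (diagKernel_nonneg φ y)
  have i0 : ∀ i : Fin N, Integrable (fun x : Fin N → E => diagKernel φ (x i))
      (Measure.pi fun _ => ν) := fun i =>
    integrable_of_abs_le _ (hdm.comp (measurable_pi_apply i)) fun x => hdb _
  have e4 : ∫ x : Fin N → E, ∑ i, diagKernel φ (x i) ∂(Measure.pi fun _ => ν) = N * n := by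
    rw [integral_finsetSum _ fun i _ => i0 i]
    simp_rw [integral_pi_single _ hdm, integral_diagKernel hφ_L2 hφ_orth]
    simp
  have i1 : Integrable (fun x : Fin N → E =>
      ((N : ℝ) ^ 2)⁻¹ * ∑ i, ∑ j, ‖projKernel φ (x i) (x j)‖ ^ 2) (Measure.pi fun _ => ν) :=
    (integrable_finsetSum _ fun i _ => integrable_finsetSum _ fun j _ =>
      integrable_of_abs_le _ ((measurable_projKernel_pi hφ_meas i j).norm.pow_const 2)
        fun x => hb (x i, x j)).const_mul _
  have i2 : Integrable (fun x : Fin N → E => 2 * (N : ℝ)⁻¹ * ∑ i, diagKernel φ (x i))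
      (Measure.pi fun _ => ν) :=
    (integrable_finsetSum _ fun i _ => i0 i).const_mul _
  have i3 : Integrable (fun x : Fin N → E =>
      ((N : ℝ) ^ 2)⁻¹ * (∑ i, ∑ j, ‖projKernel φ (x i) (x j)‖ ^ 2) -
        2 * (N : ℝ)⁻¹ * ∑ i, diagKernel φ (x i)) (Measure.pi fun _ => ν) := i1.sub i2
  simp only at e1
  simp_rw [gramError_one]
  rw [integral_add i3 (integrable_const _), integral_sub i1 i2, integral_const_mul,
    integral_const_mul, e4, e1, e2]
  simp only [integral_const, probReal_univ, smul_eq_mul, one_mul]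
  have hn0 : (0 : ℝ) ≤ n := Nat.cast_nonneg n
  have h5 : ((N : ℝ) ^ 2)⁻¹ * (N * (∫ y, ‖projKernel φ y y‖ ^ 2 ∂ν) + N * (N - 1) * n) -
      2 * (N : ℝ)⁻¹ * (N * n) + n = ((∫ y, ‖projKernel φ y y‖ ^ 2 ∂ν) - n) / N := by
    field_simp
    ring
  rw [h5]
  gcongr
  nlinarith

include hφ_meas hφ_orth hK in
/-- Concentration of the empirical Gram matrix around the identity. -/
theorem measureReal_gramError_gt_le (hN : 1 ≤ N) (hn : 1 ≤ n) {δ : ℝ}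
    (hδ : δ ∈ Set.Ioo (0 : ℝ) 1) :
    (Measure.pi fun _ : Fin N => ν).real {x |
      4 / N * Real.log (((n : ℝ) ^ 2 + 1) / δ) * K ^ 2 < gramError φ (fun _ => 1) x} ≤ δ := by
  have hN' : (0 : ℝ) < N := by exact_mod_cast hN
  have hn1 : (1 : ℝ) ≤ n := by exact_mod_cast hn
  have hnK := natCast_le_of_diagKernel_le hK hφ_L2 hφ_orth
  have hK0 : 0 < K := by linarith
  set H : (Fin N → E) → ℝ := gramError φ (fun _ => 1) with hH
  have hHm : Measurable H := measurable_gramError hφ_meas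
  have hH0 : ∀ x, 0 ≤ H x := fun x => by
    rw [hH]; unfold gramError; positivity
  obtain ⟨B, hB⟩ : ∃ B, ∀ x, |√(H x)| ≤ B := by
    refine ⟨√(K ^ 2 + n), fun x => ?_⟩
    rw [abs_of_nonneg (Real.sqrt_nonneg _)]
    apply Real.sqrt_le_sqrt
    rw [hH, gramError_one]
    have h1 : ((N : ℝ) ^ 2)⁻¹ * ∑ i, ∑ j, ‖projKernel φ (x i) (x j)‖ ^ 2 ≤ K ^ 2 := by
      calc ((N : ℝ) ^ 2)⁻¹ * ∑ i, ∑ j, ‖projKernel φ (x i) (x j)‖ ^ 2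
          ≤ ((N : ℝ) ^ 2)⁻¹ * ∑ i : Fin N, ∑ j : Fin N, K ^ 2 := by
            refine mul_le_mul_of_nonneg_left ?_ (by positivity)
            exact Finset.sum_le_sum fun i _ => Finset.sum_le_sum fun j _ =>
              norm_projKernel_sq_le_sq hK _ _
        _ = K ^ 2 := by
            simp
            field_simp
    have h2 : 0 ≤ 2 * (N : ℝ)⁻¹ * ∑ i, diagKernel φ (x i) :=
      mul_nonneg (by positivity) (Finset.sum_nonneg fun i _ => diagKernel_nonneg φ _)
    linarith
  have hFm : Measurable fun x => √(H x) := hHm.sqrt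
  set M := ∫ x, √(H x) ∂(Measure.pi fun _ : Fin N => ν)
  -- Jensen: the squared mean of the root is at most the mean of the Gram error.
  have hM : M ≤ K / √N := by
    have hmem : MemLp (fun x => √(H x)) 2 (Measure.pi fun _ : Fin N => ν) :=
      MemLp.of_bound hFm.aestronglyMeasurable B (Filter.Eventually.of_forall hB)
    have hv := variance_nonneg (fun x => √(H x)) (Measure.pi fun _ : Fin N => ν)
    rw [variance_eq_sub hmem] at hv
    have h1 : ∫ x, ((fun x => √(H x)) ^ 2) x ∂(Measure.pi fun _ : Fin N => ν) =
        ∫ x, H x ∂(Measure.pi fun _ : Fin N => ν) :=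
      integral_congr_ae (Filter.Eventually.of_forall fun x => Real.sq_sqrt (hH0 x))
    rw [h1] at hv
    have h2 := integral_gramError_le hφ_meas hK hφ_L2 hφ_orth (N := N) hN
    have h3 : M ^ 2 ≤ (K / √N) ^ 2 := by
      rw [div_pow, Real.sq_sqrt hN'.le]
      linarith
    exact le_of_sq_le_sq h3 (by positivity)
  set l := Real.log δ⁻¹ with hl
  have hl0 : 0 < l := Real.log_pos ((one_lt_inv₀ hδ.1).2 hδ.2)
  -- With differences √2 K/N, the deviation K √(l/N) makes McDiarmid's exponent equal to l =
  -- log(1/δ).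
  have ht : 0 ≤ K * √(l / N) := by positivity
  have h1 := measureReal_ge_le_of_bounded_differences ν N (fun x => √(H x)) hFm hB
    (fun x i y => abs_sqrt_gramError_sub_le φ x hK i y) ht
  have hexp : Real.exp (-(2 * (K * √(l / N)) ^ 2 / (N * (√2 * K / N) ^ 2))) = δ := by
    have : 2 * (K * √(l / N)) ^ 2 / (N * (√2 * K / N) ^ 2) = l := by
      simp only [mul_pow, div_pow]
      rw [Real.sq_sqrt (by positivity), Real.sq_sqrt (by norm_num)]
      field_simp
    rw [this, Real.exp_neg, hl, Real.exp_log (inv_pos.2 hδ.1), inv_inv]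
  rw [hexp] at h1
  refine (measureReal_mono ?_).trans h1
  intro x hx
  change K * √(l / N) ≤ √(H x) - M
  by_contra hlt
  push Not at hlt
  have hx' : 4 / N * Real.log (((n : ℝ) ^ 2 + 1) / δ) * K ^ 2 < H x := hx
  have h2 : √(H x) ≤ K / √N * (1 + √l) := by
    rw [Real.sqrt_div hl0.le] at hlt
    have : K / √N * (1 + √l) = K / √N + K * (√l / √N) := by ring
    linarith
  have h3 : H x ≤ (K / √N * (1 + √l)) ^ 2 := by
    rw [← Real.sq_sqrt (hH0 x)]
    exact pow_le_pow_left₀ (Real.sqrt_nonneg _) h2 2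
  -- Here (1 + √l)² ≤ 2 + 2l ≤ 4(log 2 + l), since log 2 > 1/2, and n² + 1 ≥ 2.
  have h4 : (1 + √l) ^ 2 ≤ 4 * Real.log (((n : ℝ) ^ 2 + 1) / δ) := by
    have h5 : Real.log 2 + l ≤ Real.log (((n : ℝ) ^ 2 + 1) / δ) := by
      rw [hl, ← Real.log_mul (by norm_num) (inv_ne_zero hδ.1.ne'), ← div_eq_mul_inv]
      have := hδ.1
      apply Real.log_le_log (by positivity)
      gcongr
      nlinarith
    have h6 := Real.log_two_gt_d9
    nlinarith [Real.sq_sqrt hl0.le, sq_nonneg (√l - 1)]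
  have h7 : (K / √N * (1 + √l)) ^ 2 ≤ 4 / N * Real.log (((n : ℝ) ^ 2 + 1) / δ) * K ^ 2 := by
    rw [mul_pow, div_pow, Real.sq_sqrt hN'.le]
    calc K ^ 2 / N * (1 + √l) ^ 2 ≤ K ^ 2 / N * (4 * Real.log (((n : ℝ) ^ 2 + 1) / δ)) := by gcongr
      _ = _ := by ring
  linarith

end Concentration

/-! ### Change of reference measure from μ to ν. -/

section Whitening

variable {E : Type*} {n : ℕ} (ψ : Fin n → E → ℂ) (ρ : E → ℝ) (K : ℝ)

/-- The set where the density is positive and the normalised kernel is bounded by `K`. -/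
def regularSet : Set E := {x | 0 < ρ x ∧ diagKernel ψ x / ρ x ≤ K}

open Classical in
/-- The functions `ψₖ ρ^{-1/2}`, truncated to the regular set. -/
noncomputable def whitened (k : Fin n) (x : E) : ℂ :=
  if x ∈ regularSet ψ ρ K then (((√(ρ x))⁻¹ : ℝ) : ℂ) * ψ k x else 0

variable {ψ ρ K}

theorem whitened_of_mem {x : E} (hx : x ∈ regularSet ψ ρ K) (k : Fin n) :
    whitened ψ ρ K k x = (((√(ρ x))⁻¹ : ℝ) : ℂ) * ψ k x := if_pos hx

/-- Truncation makes the bound hold at every point, so it survives the replacement of a coordinate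
by an arbitrary point. -/
theorem diagKernel_whitened_le (hK : 0 ≤ K) (x : E) : diagKernel (whitened ψ ρ K) x ≤ K := by
  by_cases hx : x ∈ regularSet ψ ρ K
  · refine le_trans (le_of_eq ?_) hx.2
    simp only [diagKernel, whitened_of_mem hx, norm_mul, mul_pow, Complex.norm_real,
      Real.norm_eq_abs, sq_abs, inv_pow, Real.sq_sqrt hx.1.le]
    rw [← Finset.mul_sum, div_eq_inv_mul]
  · simpa [diagKernel, whitened, hx] using hK

theorem projKernel_whitened {x y : E} (hx : x ∈ regularSet ψ ρ K) (hy : y ∈ regularSet ψ ρ K) :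
    ρ x * ρ y * ‖projKernel (whitened ψ ρ K) x y‖ ^ 2 = ‖projKernel ψ x y‖ ^ 2 := by
  have h : projKernel (whitened ψ ρ K) x y =
      (((√(ρ x))⁻¹ * (√(ρ y))⁻¹ : ℝ) : ℂ) * projKernel ψ x y := by
    simp only [projKernel, whitened_of_mem hx, whitened_of_mem hy, map_mul, Complex.conj_ofReal,
      Finset.mul_sum]
    refine Finset.sum_congr rfl fun k _ => ?_
    push_cast
    ring
  have hx1 := hx.1
  have hy1 := hy.1
  rw [h, norm_mul, Complex.norm_real, Real.norm_eq_abs, mul_pow, sq_abs, mul_pow, inv_pow, inv_pow,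
    Real.sq_sqrt hx1.le, Real.sq_sqrt hy1.le]
  field_simp

theorem whitenedMatrix_whitened {N : ℕ} {x : Fin N → E} (hx : ∀ i, x i ∈ regularSet ψ ρ K) :
    whitenedMatrix (whitened ψ ρ K) (fun _ => 1) x = whitenedMatrix ψ ρ x := by
  ext i k
  simp only [whitenedMatrix, Matrix.of_apply, whitened_of_mem (hx i)]
  push_cast
  simp
  ring

theorem gramError_whitened {N : ℕ} {x : Fin N → E} (hx : ∀ i, x i ∈ regularSet ψ ρ K) :
    gramError (whitened ψ ρ K) (fun _ => 1) x = gramError ψ ρ x := by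
  rw [gramError, gramError, whitenedMatrix_whitened hx]

theorem empiricalVar_whitened {N : ℕ} {x : Fin N → E} (hx : ∀ i, x i ∈ regularSet ψ ρ K)
    (f : E → ℝ) :
    empiricalVar (whitened ψ ρ K) (fun _ => 1) f x = empiricalVar ψ ρ f x := by
  rw [empiricalVar, empiricalVar, lMatrix_eq, lMatrix_eq, whitenedMatrix_whitened hx]

variable [MeasurableSpace E] {μ ν : Measure E} (hψ_meas : ∀ k, Measurable (ψ k))
  (hρ_meas : Measurable ρ)

include hψ_meas hρ_meas

theorem measurableSet_regularSet : MeasurableSet (regularSet ψ ρ K) :=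
  (measurableSet_lt measurable_const hρ_meas).inter
    (measurableSet_le ((measurable_diagKernel hψ_meas).div hρ_meas) measurable_const)

theorem measurable_whitened (k : Fin n) : Measurable (whitened ψ ρ K k) := by
  unfold whitened
  exact Measurable.ite (measurableSet_regularSet hψ_meas hρ_meas)
    ((Complex.measurable_ofReal.comp hρ_meas.sqrt.inv).mul (hψ_meas k)) measurable_const

theorem memLp_whitened [IsFiniteMeasure ν] (hK : 0 ≤ K) (k : Fin n) :
    MemLp (whitened ψ ρ K k) 2 ν := by
  refine MemLp.of_bound (measurable_whitened hψ_meas hρ_meas k).aestronglyMeasurable (√K)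
    (Filter.Eventually.of_forall fun x => ?_)
  apply Real.le_sqrt_of_sq_le
  refine le_trans ?_ (diagKernel_whitened_le (ψ := ψ) (ρ := ρ) hK x)
  exact Finset.single_le_sum (f := fun k => ‖whitened ψ ρ K k x‖ ^ 2)
    (fun _ _ => by positivity) (Finset.mem_univ k)

variable (hν : ν = μ.withDensity fun x => ENNReal.ofReal (ρ x))
  (hreg : ∀ᵐ x ∂μ, x ∈ regularSet ψ ρ K)
include hν hreg

/-- The density ρ of ν cancels the two factors ρ^{-1/2}, and the truncation is invisible μ-almost
everywhere. -/
theorem orthonormal_whitened [IsFiniteMeasure ν] (hK : 0 ≤ K) (hψ_L2 : ∀ k, MemLp (ψ k) 2 μ)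
    (hψ_orth : Orthonormal ℂ fun k => (hψ_L2 k).toLp (ψ k)) :
    Orthonormal ℂ fun k => (memLp_whitened (ν := ν) hψ_meas hρ_meas hK k).toLp
      (whitened ψ ρ K k) := by
  rw [orthonormal_iff_ite]
  intro k l
  rw [← integral_conj_mul hψ_L2 hψ_orth k l, L2.inner_def]
  have h1 : ∫ x, inner ℂ ((memLp_whitened (ν := ν) hψ_meas hρ_meas hK k).toLp
      (whitened ψ ρ K k) x) ((memLp_whitened (ν := ν) hψ_meas hρ_meas hK l).toLp
      (whitened ψ ρ K l) x) ∂ν =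
      ∫ x, (starRingEnd ℂ) (whitened ψ ρ K k x) * whitened ψ ρ K l x ∂ν := by
    refine integral_congr_ae ?_
    filter_upwards [(memLp_whitened (ν := ν) hψ_meas hρ_meas hK k).coeFn_toLp,
      (memLp_whitened (ν := ν) hψ_meas hρ_meas hK l).coeFn_toLp] with y hk hl
    rw [hk, hl, RCLike.inner_apply, mul_comm]
  rw [h1, hν, integral_withDensity_eq_integral_toReal_smul hρ_meas.ennreal_ofReal (by simp)]
  refine integral_congr_ae ?_
  filter_upwards [hreg] with x hx
  have hx1 := hx.1
  have h2 : ρ x * ((√(ρ x))⁻¹ * (√(ρ x))⁻¹) = 1 := by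
    rw [← mul_inv, Real.mul_self_sqrt hx1.le, mul_inv_cancel₀ hx1.ne']
  have h3 : (ρ x : ℂ) * ((((√(ρ x))⁻¹ : ℝ) : ℂ) * (((√(ρ x))⁻¹ : ℝ) : ℂ)) = 1 := by
    exact_mod_cast h2
  rw [ENNReal.toReal_ofReal hx1.le, whitened_of_mem hx, whitened_of_mem hx, Complex.real_smul,
    map_mul, Complex.conj_ofReal]
  linear_combination ((starRingEnd ℂ) (ψ k x) * ψ l x) * h3

omit hψ_meas in
-- The density ρ(x)ρ(y) of ν ⊗ ν cancels the normalisation of |K|², so the limit functional is that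
-- of the original DPP.
theorem integral_whitened_eq [SFinite μ] (f : E → ℝ) :
    ∫ p : E × E, (f p.1 - f p.2) ^ 2 * ‖projKernel (whitened ψ ρ K) p.1 p.2‖ ^ 2 ∂(ν.prod ν) =
      ∫ p : E × E, (f p.1 - f p.2) ^ 2 * ‖projKernel ψ p.1 p.2‖ ^ 2 ∂(μ.prod μ) := by
  have hm := hρ_meas.ennreal_ofReal
  rw [hν, prod_withDensity hm hm, integral_withDensity_eq_integral_toReal_smul (by fun_prop)
    (Filter.Eventually.of_forall fun p => by
      exact ENNReal.mul_lt_top ENNReal.ofReal_lt_top ENNReal.ofReal_lt_top)]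
  refine integral_congr_ae ?_
  filter_upwards [Measure.quasiMeasurePreserving_fst.ae hreg,
    Measure.quasiMeasurePreserving_snd.ae hreg] with p h1 h2
  have h11 := h1.1
  have h21 := h2.1
  rw [← projKernel_whitened h1 h2, ENNReal.toReal_mul, ENNReal.toReal_ofReal h11.le,
    ENNReal.toReal_ofReal h21.le, smul_eq_mul]
  ring

end Whitening

theorem abs_le_supNorm {E : Type*} {f : E → ℝ} (hf : ∃ C, ∀ x, |f x| ≤ C) (x : E) :
    |f x| ≤ supNorm f := by
  obtain ⟨C, hC⟩ := hf
  exact le_ciSup (f := fun x => |f x|) ⟨C, by rintro _ ⟨y, rfl⟩; exact hC y⟩ x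

end DPP

/-! ### The variance bounds on the good event. -/

theorem theorem1 {E : Type*} [TopologicalSpace E] [PolishSpace E] [MeasurableSpace E]
    [BorelSpace E] (μ : Measure E) [SigmaFinite μ]
    -- the orthonormal functions spanning the range of the projection kernel
    (n : ℕ) (hn : 1 ≤ n) (ψ : Fin n → E → ℂ) (hψ_meas : ∀ k, Measurable (ψ k))
    (hψ_L2 : ∀ k, MemLp (ψ k) 2 μ)
    (hψ_orth : Orthonormal ℂ fun k => (hψ_L2 k).toLp (ψ k))
    -- the continuous DPP
    {Ω_c : Type*} [MeasurableSpace Ω_c] (P_c : Measure Ω_c) [IsProbabilityMeasure P_c]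
    (S_c : Ω_c → Set E) (hS_c : DPP.IsDPP P_c S_c (DPP.projKernel ψ) μ)
    -- the sampling density
    (ρ : E → ℝ) (hρ_meas : Measurable ρ) (hρ_pos : ∀ᵐ x ∂μ, 0 < ρ x)
    (ν : Measure E) (hν : ν = μ.withDensity fun x => ENNReal.ofReal (ρ x))
    [IsProbabilityMeasure ν] [NullSingletonClass ν]
    -- the i.i.d. data
    (N : ℕ) (hN : 1 ≤ N) {Ω : Type*} [MeasurableSpace Ω] (P : Measure Ω)
    [IsProbabilityMeasure P] (X : Fin N → Ω → E) (hX_meas : ∀ i, Measurable (X i))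
    (hX_indep : iIndepFun X P) (hX_law : ∀ i, P.map (X i) = ν)
    -- the test function and the bound on the kernel
    (f : E → ℝ) (hf_meas : Measurable f) (hf_bdd : ∃ C, ∀ x, |f x| ≤ C)
    (K_max : ℝ) (hK : ∀ᵐ x ∂ν, (DPP.projKernel ψ x x).re / ρ x ≤ K_max)
    (δ δ' : ℝ) (hδ : δ ∈ Set.Ioo (0 : ℝ) 1) (hδ' : δ' ∈ Set.Ioo (0 : ℝ) 1) :
    ∃ A : Set Ω, MeasurableSet A ∧ 1 - δ - δ' ≤ P.real A ∧ ∀ ω ∈ A,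
      DPP.discreteVar ψ ρ f (fun i => X i ω) ≤
          2 * variance (fun η => DPP.linStat f (S_c η)) P_c
            + 4 * DPP.supNorm f ^ 2 * K_max ^ 2 * DPP.errorTerm n N δ δ' ∧
      ((N : ℝ) - 1) / (2 * N) * variance (fun η => DPP.linStat f (S_c η)) P_c
            - 2 * DPP.supNorm f ^ 2 * K_max ^ 2 * DPP.errorTerm n N δ δ' ≤
        DPP.discreteVar ψ ρ f (fun i => X i ω) := by
  have hN1 : (1 : ℝ) ≤ N := by exact_mod_cast hN
  have hN0 : (0 : ℝ) < N := by linarith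
  -- Positivity of ρ makes a ν-null set μ-null, so the kernel bound transfers to μ.
  have hreg : ∀ᵐ x ∂μ, x ∈ DPP.regularSet ψ ρ K_max := by
    rw [hν, ae_withDensity_iff hρ_meas.ennreal_ofReal] at hK
    filter_upwards [hK, hρ_pos] with x hx hρx
    have h := hx (by simpa using hρx)
    rw [DPP.projKernel_self, Complex.ofReal_re] at h
    exact ⟨hρx, h⟩
  have hregν : ∀ᵐ x ∂ν, x ∈ DPP.regularSet ψ ρ K_max := by
    rw [hν]
    exact (withDensity_absolutelyContinuous μ _).ae_le hreg
  have hK0 : 0 ≤ K_max := by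
    obtain ⟨x, hx⟩ := hregν.exists
    exact (div_nonneg (DPP.diagKernel_nonneg ψ x) hx.1.le).trans hx.2
  set φ := DPP.whitened ψ ρ K_max
  have hφ_meas : ∀ k, Measurable (φ k) := DPP.measurable_whitened hψ_meas hρ_meas
  have hφK : ∀ y, DPP.diagKernel φ y ≤ K_max := DPP.diagKernel_whitened_le hK0
  have hφ_L2 : ∀ k, MemLp (φ k) 2 ν := DPP.memLp_whitened hψ_meas hρ_meas hK0
  have hφ_orth : Orthonormal ℂ fun k => (hφ_L2 k).toLp (φ k) :=
    DPP.orthonormal_whitened hψ_meas hρ_meas hν hreg hK0 hψ_L2 hψ_orth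
  have hKpos : 0 < K_max := by
    have h1 := DPP.natCast_le_of_diagKernel_le hφK hφ_L2 hφ_orth
    have h2 : (1 : ℝ) ≤ n := by exact_mod_cast hn
    linarith
  have hC := DPP.abs_le_supNorm hf_bdd
  set C := DPP.supNorm f
  set σ := variance (fun η => DPP.linStat f (S_c η)) P_c with hσ
  have hσ0 : 0 ≤ σ := variance_nonneg _ _
  have hmean : ∫ x : Fin N → E, DPP.empiricalVar φ (fun _ => 1) f x ∂(Measure.pi fun _ => ν) =
      ((N : ℝ) - 1) / N * σ := by
    rw [DPP.integral_empiricalVar hφ_meas hφK hN hf_meas hC,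
      DPP.integral_whitened_eq hρ_meas hν hreg, hσ,
      hS_c.variance_linStat hψ_meas hψ_L2 hψ_orth hf_meas hC]
  set t := 2 * C ^ 2 * K_max ^ 2 * √(2 * Real.log (2 / δ') / N)
  set h := 4 / N * Real.log (((n : ℝ) ^ 2 + 1) / δ) * K_max ^ 2
  -- The bad event: a large deviation of the variance functional (mass at most δ'), a large Gram
  -- error (at most δ), or a sample point outside the regular set (null).
  set B1 : Set (Fin N → E) :=
    {x | t < |DPP.empiricalVar φ (fun _ => 1) f x - ((N : ℝ) - 1) / N * σ|}
  set B2 : Set (Fin N → E) := {x | h < DPP.gramError φ (fun _ => 1) x}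
  set B3 : Set (Fin N → E) := ⋃ i, {x | x i ∈ (DPP.regularSet ψ ρ K_max)ᶜ}
  have hB1 : (Measure.pi fun _ : Fin N => ν).real B1 ≤ δ' := by
    have := DPP.measureReal_empiricalVar_deviation_le (ν := ν) (N := N) hφ_meas hφK hN hKpos
      hf_meas hC hδ'
    rwa [hmean] at this
  have hB2 : (Measure.pi fun _ : Fin N => ν).real B2 ≤ δ :=
    DPP.measureReal_gramError_gt_le hφ_meas hφK hφ_L2 hφ_orth hN hn hδ
  have hB3 : (Measure.pi fun _ : Fin N => ν).real B3 = 0 := by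
    rw [measureReal_def, measure_iUnion_null fun i => ?_, ENNReal.toReal_zero]
    exact (measurePreserving_eval (fun _ : Fin N => ν) i).quasiMeasurePreserving.ae hregν
  have hmB1 : MeasurableSet B1 := measurableSet_lt measurable_const
    ((DPP.measurable_empiricalVar hφ_meas hf_meas).sub_const _).abs
  have hmB2 : MeasurableSet B2 :=
    measurableSet_lt measurable_const (DPP.measurable_gramError hφ_meas)
  have hmB3 : MeasurableSet B3 := MeasurableSet.iUnion fun i =>
    measurable_pi_apply i (DPP.measurableSet_regularSet hψ_meas hρ_meas).compl
  have hmB : MeasurableSet (B1 ∪ B2 ∪ B3) := (hmB1.union hmB2).union hmB3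
  have hXm : Measurable fun ω i => X i ω := measurable_pi_lambda _ hX_meas
  have hlaw : P.map (fun ω i => X i ω) = Measure.pi fun _ => ν := by
    rw [(iIndepFun_iff_map_fun_eq_pi_map fun i => (hX_meas i).aemeasurable).1 hX_indep]
    simp_rw [hX_law]
  refine ⟨(fun ω i => X i ω) ⁻¹' (B1 ∪ B2 ∪ B3)ᶜ, hXm hmB.compl, ?_, ?_⟩
  · rw [← map_measureReal_apply hXm hmB.compl, hlaw, probReal_compl_eq_one_sub hmB]
    have h1 := measureReal_union_le (μ := Measure.pi fun _ : Fin N => ν) (B1 ∪ B2) B3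
    have h2 := measureReal_union_le (μ := Measure.pi fun _ : Fin N => ν) B1 B2
    linarith
  · intro ω hω
    set x : Fin N → E := fun i => X i ω
    have hx : x ∉ B1 ∪ B2 ∪ B3 := hω
    simp only [Set.mem_union, not_or] at hx
    obtain ⟨⟨hx1, hx2⟩, hx3⟩ := hx
    have hxr : ∀ i, x i ∈ DPP.regularSet ψ ρ K_max := by
      intro i
      by_contra hi
      exact hx3 (Set.mem_iUnion.2 ⟨i, hi⟩)
    have hV : |DPP.empiricalVar ψ ρ f x - ((N : ℝ) - 1) / N * σ| ≤ t := by
      rw [← DPP.empiricalVar_whitened hxr]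
      exact not_lt.1 hx1
    have hG : DPP.gramError ψ ρ x ≤ h := by
      rw [← DPP.gramError_whitened hxr]
      exact not_lt.1 hx2
    obtain ⟨hup, hlow⟩ := DPP.discreteVar_bounds ψ ρ f x hN (fun i => (hxr i).1) hC
    have hV' := abs_le.1 hV
    set s := √(2 * Real.log (2 / δ') / N)
    have hs : 0 ≤ s := Real.sqrt_nonneg _
    -- The squared logarithm in the error term is nonnegative slack. So is part of the factor 4
    -- before the root: the upper bound needs only 2t = 4C²K_max² s, and the lower one t/2.
    have herr : 4 * C ^ 2 * K_max ^ 2 * (4 * s) + 4 * C ^ 2 * h ≤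
        4 * C ^ 2 * K_max ^ 2 * DPP.errorTerm n N δ δ' := by
      have h1 : 0 ≤ 4 / (9 * (N : ℝ) ^ 2) * Real.log (((n : ℝ) ^ 2 + 1) / δ) ^ 2 := by positivity
      have h2 := mul_le_mul_of_nonneg_left h1 (by positivity : 0 ≤ 4 * C ^ 2 * K_max ^ 2)
      have h3 : 4 * C ^ 2 * K_max ^ 2 * DPP.errorTerm n N δ δ' =
          4 * C ^ 2 * K_max ^ 2 * (4 * s) + 4 * C ^ 2 * h + 4 * C ^ 2 * K_max ^ 2 *
            (4 / (9 * (N : ℝ) ^ 2) * Real.log (((n : ℝ) ^ 2 + 1) / δ) ^ 2) := by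
        simp only [DPP.errorTerm, h, s]
        ring
      linarith
    have hG' := mul_le_mul_of_nonneg_left hG (by positivity : 0 ≤ 4 * C ^ 2)
    have hCs : 0 ≤ C ^ 2 * K_max ^ 2 * s := by positivity
    have hts : t = 2 * (C ^ 2 * K_max ^ 2 * s) := by simp only [t, s]; ring
    constructor
    · have h1 : ((N : ℝ) - 1) / N * σ ≤ σ := by
        have : ((N : ℝ) - 1) / N ≤ 1 := by rw [div_le_one hN0]; linarith
        nlinarith
      linarith
    · have h2 : ((N : ℝ) - 1) / (2 * N) * σ = ((N : ℝ) - 1) / N * σ / 2 := by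
        field_simp
      rw [h2]
      linarith
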